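/- Let $\alpha_1,\dots,\alpha_n$ ($n\ge 1$) be the simple roots, numbered in any fixed way, of an irreducible reduced crystallographic root system $\Pi$ spanning the Euclidean space $\mathbb R^n$ with scalar product $\langle\cdot,\cdot\rangle$. Let $W$ be its Weyl group, $\alpha_i^\vee=2\alpha_i/\langle\alpha_i,\alpha_i\rangle$ the dual simple roots, $\xi$ the highest root, $\eta$ the highest dual root, $Q^\vee=\bigoplus_i\mathbb Z\alpha_i^\vee$ the dual root lattice and $P=\{\omega\in\mathbb R^n:\langle\omega,\alpha_i^\vee\rangle\in\mathbb Z\text{ for all }i\}$ the weight lattice. Let $W^{\mathrm{aff}}=Q^\vee\rtimes W$ and $W_P^{\mathrm{aff}}=P\rtimes W$ act on $\mathbb R^n$ by $T(v)w\cdot a=wa+v$, and let $\psi(T(v)w)=w$ denote the retraction onto $W$ in both cases. Let $\sigma:W\to\{\pm1\}$ be a homomorphism and $M\ge 1$ an integer. Let $F=\{a:\langle a,\alpha_i\rangle\ge 0\ (1\le i\le n),\ \langle a,\xi\rangle\le 1\}$ and $F_Q=\{b: b_0,\dots,b_n\ge 0\}$, where $b_0=1-\langle b,\eta\rangle$ and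 $b_i=\langle b,\alpha_i^\vee\rangle$ for $1\le i\le n$ are the Kac coordinates $[b_0,\dots,b_n]$ of $b$. Let $\Gamma=\{\gamma\in W_P^{\mathrm{aff}}:\gamma F_Q=F_Q\}$, and let $F_P$ be the set of those $b\in F_Q$ whose Kac coordinates are lexicographically highest in the orbit $\Gamma b$. Put $$F^\sigma=\{a\in F:\sigma\circ\psi(\mathrm{Stab}_{W^{\mathrm{aff}}}(a))=\{1\}\},\qquad F_P^\sigma=\{b\in F_P:\sigma\circ\psi(\mathrm{Stab}_{W_P^{\mathrm{aff}}}(b))=\{1\}\},$$ $$F^\sigma_{Q^\vee,M}=\tfrac1M Q^\vee\cap F^\sigma,\qquad \Lambda^\sigma_{P,M}=P\cap MF_P^\sigma,$$ $$\varepsilon(a)=\frac{|W|}{|\mathrm{Stab}_{W^{\mathrm{aff}}}(a)|},\qquad h_{P,M}(b)=\left|\mathrm{Stab}_{W_P^{\mathrm{aff}}}(b/M)\right| .$$ For functions $f,g:F^\sigma_{Q^\vee,M}\to\mathbb C$ on the finite set $F^\sigma_{Q^\vee,M}$ let $$\langle f,g\rangle^\sigma_M=\sum_{s\in F^\sigma_{Q^\vee,M}}\varepsilon(s)\,f(s)\,\overline{g(s)}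 .$$ For $b\in\mathbb R^n$ let $\zeta^\sigma_b:\mathbb R^n\to\mathbb R$ be the Hartley orbit function $$\zeta^\sigma_b(a)=\sum_{w\in W}\sigma(w)\bigl(\cos(2\pi\langle wb,a\rangle)+\sin(2\pi\langle wb,a\rangle)\bigr),$$ that is, $\zeta^\sigma_b=\mathrm{Re}\,\varphi^\sigma_b+\mathrm{Im}\,\varphi^\sigma_b$ for the Weyl orbit function $\varphi^\sigma_b(a)=\sum_{w\in W}\sigma(w)e^{2\pi i\langle wb,a\rangle}$. Then for all $\lambda,\lambda'\in\Lambda^\sigma_{P,M}$, $$\langle\zeta^\sigma_\lambda,\zeta^\sigma_{\lambda'}\rangle^\sigma_M=|W|\,M^n\,h_{P,M}(\lambda)\,\delta_{\lambda\lambda'} .$$ -/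

import Mathlib

/-- A finite irreducible reduced crystallographic root system with a base has a highest root. -/
theorem exists_highest_root {ι V V' : Type*} [Finite ι] [AddCommGroup V] [Module ℝ V]
    [AddCommGroup V'] [Module ℝ V'] (R : RootPairing ι ℝ V V') [R.IsRootSystem]
    [R.IsCrystallographic] [R.IsReduced] [R.IsIrreducible] (b : R.Base) :
    ∃ k, ∀ j, R.root k - R.root j ∈ AddSubmonoid.closure (R.root '' b.support) := by
  classical
  have : Module.IsReflexive ℝ V := .of_isPerfPair R.toLinearMap
  have hne : Nonempty ι := by
    by_contra h
    rw [not_nonempty_iff] at h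
    have h1 := RootPairing.IsRootSystem.span_root_eq_top (P := R)
    have h2 : Nontrivial V := RootPairing.IsIrreducible.nontrivial R
    rw [Set.range_eq_empty, Submodule.span_empty] at h1
    exact bot_ne_top h1
  let _ := R.indexNeg
  -- positive roots are combinations of simple roots with nonnegative coefficients
  have hmem (i : ι) : b.IsPos i → R.root i ∈ AddSubmonoid.closure (R.root '' b.support) := by
    intro hi
    refine hi.induction_on_add (p := fun i => R.root i ∈ AddSubmonoid.closure (R.root '' b.support))
      ?_ ?_
    · intro i hi
      exact AddSubmonoid.subset_closure ⟨i, hi, rfl⟩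
    · intro i j k hk hi hj
      rw [hk]
      exact add_mem hi (AddSubmonoid.subset_closure ⟨j, hj, rfl⟩)
  -- a maximal root is dominant and has full support
  have key (k : ι) (hk : ∀ j, R.root j - R.root k ∈ AddSubmonoid.closure (R.root '' b.support) →
      b.height j ≤ b.height k) :
      (∀ i ∈ b.support, 0 ≤ R.pairingIn ℤ k i) ∧
      ∃ f : ι → ℤ, (∀ i ∈ b.support, 0 < f i) ∧ R.root k = ∑ i ∈ b.support, f i • R.root i := by
    have hdom : ∀ i ∈ b.support, 0 ≤ R.pairingIn ℤ k i := by
      intro i hi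
      by_contra! hneg
      have hh := b.height_one_of_mem_support hi
      by_cases hki : R.root k = - R.root i
      · have h1 : k = -i := by
          apply R.root.injective
          simpa using hki
        have h2 : b.height k = -1 := by
          rw [h1, b.height_reflectionPerm_self, hh]
        have := hk i (by
          rw [hki, sub_neg_eq_add]
          have : R.root i ∈ AddSubmonoid.closure (R.root '' b.support) :=
            AddSubmonoid.subset_closure ⟨i, hi, rfl⟩
          exact add_mem this this)
        omega
      · obtain ⟨l, hl⟩ := R.root_add_root_mem_of_pairingIn_neg hneg hki
        have h1 := b.height_add hl
        have := hk l (by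
          rw [hl, add_sub_cancel_left]
          exact AddSubmonoid.subset_closure ⟨i, hi, rfl⟩)
        omega
    refine ⟨hdom, ?_⟩
    have hpos : b.IsPos k := by
      by_contra hn
      rw [← RootPairing.Base.IsPos.neg_iff_not] at hn
      have h1 := hk (-k) (by
        have h2 := hmem _ hn
        have h3 : R.root (-k) = - R.root k := by simp
        rw [sub_eq_add_neg, ← h3]
        exact add_mem h2 h2)
      rw [b.height_reflectionPerm_self] at h1
      rw [RootPairing.Base.isPos_iff, b.height_reflectionPerm_self] at hn
      omega
    obtain ⟨f, hf0, hf1, hf2⟩ := b.exists_root_eq_sum_int k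
    have hfpos : 0 < f := by
      rcases hf1 with h | h
      · exact h
      · exfalso
        have h1 := RootPairing.Base.height_eq_sum hf2
        rw [RootPairing.Base.isPos_iff, h1] at hpos
        have : ∑ j ∈ b.support, f j ≤ 0 := Finset.sum_nonpos fun i _ => h.le i
        omega
    refine ⟨f, ?_, hf2⟩
    have hpair (j : ι) : R.pairingIn ℤ k j = ∑ i ∈ b.support, f i * R.pairingIn ℤ i j := by
      have h1 : (R.pairingIn ℤ k j : ℝ) = ((∑ i ∈ b.support, f i * R.pairingIn ℤ i j : ℤ) : ℝ) := by
        have e (i : ι) : (R.pairingIn ℤ i j : ℝ) = R.toLinearMap (R.root i) (R.coroot j) := by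
          have := R.algebraMap_pairingIn ℤ i j
          simpa using this
        push_cast
        rw [e, hf2]
        simp [e]
      exact_mod_cast h1
    obtain ⟨i0, hi0⟩ : ∃ i, i ∈ b.support ∧ f i ≠ 0 := by
      obtain ⟨i, hi⟩ := (Pi.lt_def.mp hfpos).2
      exact ⟨i, by simpa using hf0 (by simpa using hi.ne'), by simpa using hi.ne'⟩
    intro j hj
    have := b.induction_on_cartanMatrix (p := fun i => f i ≠ 0) (i := ⟨i0, hi0.1⟩) (j := ⟨j, hj⟩)
      hi0.2 (by
        rintro ⟨i, hi⟩ ⟨l, hl⟩ hfi hc hfl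
        dsimp only at hfi hfl
        have hc' : R.pairingIn ℤ i l ≠ 0 := by
          have : b.cartanMatrix ⟨i, hi⟩ ⟨l, hl⟩ ≠ 0 := fun h =>
            hc (b.cartanMatrix_apply_eq_zero_iff_symm.mp h)
          exact this
        have h1 : ∀ m ∈ b.support, f m * R.pairingIn ℤ m l ≤ 0 := by
          intro m hm
          rcases eq_or_ne m l with rfl | hml
          · simp [hfl]
          · exact mul_nonpos_of_nonneg_of_nonpos (hfpos.le m) (b.pairingIn_le_zero_of_ne hml hm hl)
        have h2 : f i * R.pairingIn ℤ i l < 0 := by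
          refine lt_of_le_of_ne (h1 i hi) (mul_ne_zero hfi hc')
        have h3 : ∑ m ∈ b.support, f m * R.pairingIn ℤ m l < 0 :=
          Finset.sum_neg' h1 ⟨i, hi, h2⟩
        have := hdom l hl
        rw [hpair] at this
        omega)
    exact lt_of_le_of_ne (hfpos.le j) (Ne.symm this)
  obtain ⟨k, hk⟩ := Finite.exists_max (fun i => b.height i)
  obtain ⟨kdom, f, fpos, hf⟩ := key k fun j _ => hk j
  refine ⟨k, fun j => ?_⟩
  obtain ⟨l, hl1, hl2⟩ := Set.Finite.exists_maximalFor (fun i => b.height i)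
    {i | R.root i - R.root j ∈ AddSubmonoid.closure (R.root '' b.support)} (Set.toFinite _)
    ⟨j, by simp⟩
  have hl : ∀ i, R.root i - R.root l ∈ AddSubmonoid.closure (R.root '' b.support) →
      b.height i ≤ b.height l := by
    intro i hi
    by_contra! hlt
    have := hl2 (j := i) (by
      have := add_mem hi hl1
      simpa using this) hlt.le
    dsimp only at this
    omega
  obtain ⟨ldom, g, gpos, hg⟩ := key l hl
  suffices k = l by rw [this]; exact hl1
  by_contra hkl
  have hp : 0 < R.pairingIn ℤ k l := by
    have hpair : R.pairingIn ℤ k l = ∑ i ∈ b.support, f i * R.pairingIn ℤ i l := by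
      have h1 : (R.pairingIn ℤ k l : ℝ) = ((∑ i ∈ b.support, f i * R.pairingIn ℤ i l : ℤ) : ℝ) := by
        have e (i : ι) : (R.pairingIn ℤ i l : ℝ) = R.toLinearMap (R.root i) (R.coroot l) := by
          have := R.algebraMap_pairingIn ℤ i l
          simpa using this
        push_cast
        rw [e, hf]
        simp [e]
      exact_mod_cast h1
    rw [hpair]
    have hnn : ∀ i ∈ b.support, 0 ≤ R.pairingIn ℤ i l := by
      intro i hi
      by_contra! h
      have := R.pairingIn_pairingIn_mem_set_of_isCrystallographic i l
      have h2 := ldom i hi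
      simp only [Set.mem_insert_iff, Set.mem_singleton_iff, Prod.mk.injEq] at this
      omega
    obtain ⟨i, hi, hi0⟩ := b.exists_mem_support_pos_pairingIn_ne_zero l
    refine Finset.sum_pos' (fun m hm => mul_nonneg (fpos m hm).le (hnn m hm))
      ⟨i, hi, mul_pos (fpos i hi) (lt_of_le_of_ne (hnn i hi) (Ne.symm hi0))⟩
  obtain ⟨m, hm⟩ := R.root_sub_root_mem_of_pairingIn_pos hp hkl
  have hh := b.height_sub hm
  rcases RootPairing.Base.IsPos.or_neg b m with h | h
  · have h1 := hmem m h
    rw [hm] at h1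
    have := hl k h1
    rw [RootPairing.Base.isPos_iff] at h
    omega
  · rw [RootPairing.Base.isPos_iff, b.height_reflectionPerm_self] at h
    have := hk l
    omega

open scoped RealInnerProductSpace Pointwise

noncomputable section

/-- The data of a simple root system in `ℝⁿ`: a finite irreducible reduced crystallographic root
system whose pairing is the standard scalar product and whose coroots are `2α / ⟨α, α⟩`, together
with a base and a numbering `α₁, …, αₙ` of the simple roots. -/
structure SimpleRootSystem (n : ℕ) where
  /-- index set of the roots -/
  ι : Type
  /-- the roots and dual roots -/
  R : RootPairing ι ℝ (EuclideanSpace ℝ (Fin n)) (EuclideanSpace ℝ (Fin n))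
  finite : Finite ι
  isRootSystem : R.IsRootSystem
  isCrystallographic : R.IsCrystallographic
  isReduced : R.IsReduced
  isIrreducible : R.IsIrreducible
  pairing_eq : ∀ x y, R.toLinearMap x y = ⟪x, y⟫
  coroot_eq : ∀ i, R.coroot i = (2 / ⟪R.root i, R.root i⟫) • R.root i
  /-- the set of simple roots -/
  base : R.Base
  /-- the numbering of the simple roots -/
  numbering : Fin n ≃ base.support

namespace SimpleRootSystem

attribute [instance] finite isRootSystem isCrystallographic isReduced isIrreducible

variable {n : ℕ} (S : SimpleRootSystem n)

/-- The simple root `αᵢ`. -/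
def simpleRoot (i : Fin n) : EuclideanSpace ℝ (Fin n) := S.R.root (S.numbering i)

/-- The dual simple root `αᵢ^∨ = 2αᵢ / ⟨αᵢ, αᵢ⟩`. -/
def simpleCoroot (i : Fin n) : EuclideanSpace ℝ (Fin n) := S.R.coroot (S.numbering i)

/-- The highest root `ξ`: `ξ - β` is a combination of simple roots with nonnegative integer
coefficients for every root `β`. -/
def highestRoot : EuclideanSpace ℝ (Fin n) :=
  S.R.root (exists_highest_root S.R S.base).choose

/-- The highest dual root `η`. -/
def highestCoroot : EuclideanSpace ℝ (Fin n) :=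
  S.R.coroot (exists_highest_root S.R.flip S.base.flip).choose

lemma highestRoot_sub_mem (j : S.ι) :
    S.highestRoot - S.R.root j ∈ AddSubmonoid.closure (Set.range S.simpleRoot) := by
  have e : S.R.root '' S.base.support = Set.range S.simpleRoot := by
    ext x
    constructor
    · rintro ⟨i, hi, rfl⟩
      exact ⟨S.numbering.symm ⟨i, hi⟩, by simp [simpleRoot]⟩
    · rintro ⟨i, rfl⟩
      exact ⟨_, (S.numbering i).2, rfl⟩
  rw [← e]
  exact (exists_highest_root S.R S.base).choose_spec j

lemma highestCoroot_sub_mem (j : S.ι) :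
    S.highestCoroot - S.R.coroot j ∈ AddSubmonoid.closure (Set.range S.simpleCoroot) := by
  have e : S.R.coroot '' S.base.support = Set.range S.simpleCoroot := by
    ext x
    constructor
    · rintro ⟨i, hi, rfl⟩
      exact ⟨S.numbering.symm ⟨i, hi⟩, by simp [simpleCoroot]⟩
    · rintro ⟨i, rfl⟩
      exact ⟨_, (S.numbering i).2, rfl⟩
  rw [← e]
  exact (exists_highest_root S.R.flip S.base.flip).choose_spec j

/-- The Weyl group `W`, generated by the reflections in the roots (equivalently in the simple
roots); it acts linearly on `ℝⁿ`. -/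
abbrev W : Subgroup S.R.Aut := S.R.weylGroup

instance finite_W : Finite S.W := by
  refine Finite.of_injective (fun w : S.W => fun i => S.R.weylGroupToPerm w i) ?_
  intro w v h
  apply Subtype.ext
  apply RootPairing.Equiv.weightHom_injective
  apply LinearEquiv.toLinearMap_injective
  apply LinearMap.ext_on_range (RootPairing.IsRootSystem.span_root_eq_top (P := S.R))
  intro i
  have h1 := S.R.weylGroup_apply_root w i
  have h2 := S.R.weylGroup_apply_root v i
  have h3 : S.R.weylGroupToPerm w i = S.R.weylGroupToPerm v i := congrFun h i
  rw [h3, ← h2] at h1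
  exact h1

instance fintype_W : Fintype S.W := Fintype.ofFinite _

/-- The dual root lattice `Q^∨`, the integer span of the dual simple roots. -/
def dualRootLattice : AddSubgroup (EuclideanSpace ℝ (Fin n)) :=
  AddSubgroup.closure (Set.range S.simpleCoroot)

/-- The weight lattice `P`, dual to the dual root lattice. -/
def weightLattice : AddSubgroup (EuclideanSpace ℝ (Fin n)) where
  carrier := {x | ∀ i, ∃ k : ℤ, ⟪x, S.simpleCoroot i⟫ = k}
  zero_mem' i := ⟨0, by simp⟩
  add_mem' {x y} hx hy i := by
    obtain ⟨k, hk⟩ := hx i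
    obtain ⟨l, hl⟩ := hy i
    exact ⟨k + l, by rw [inner_add_left, hk, hl]; push_cast; rfl⟩
  neg_mem' {x} hx i := by
    obtain ⟨k, hk⟩ := hx i
    exact ⟨-k, by rw [inner_neg_left, hk]; push_cast; rfl⟩

lemma inner_root_coroot_int (i j : S.ι) : ∃ k : ℤ, ⟪S.R.root i, S.R.coroot j⟫ = k := by
  refine ⟨S.R.pairingIn ℤ i j, ?_⟩
  rw [← S.pairing_eq]
  have := S.R.algebraMap_pairingIn ℤ i j
  simpa using this.symm

lemma coroot_mem_dualRootLattice (j : S.ι) : S.R.coroot j ∈ S.dualRootLattice := by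
  have h := S.base.coroot_mem_span_int j
  rw [← AddSubgroup.toIntSubmodule_closure] at h
  refine AddSubgroup.closure_mono ?_ h
  rintro _ ⟨i, hi, rfl⟩
  exact ⟨S.numbering.symm ⟨i, hi⟩, by simp [simpleCoroot]⟩

lemma inner_weight_coroot_int {x : EuclideanSpace ℝ (Fin n)} (hx : x ∈ S.weightLattice)
    {q : EuclideanSpace ℝ (Fin n)} (hq : q ∈ S.dualRootLattice) : ∃ k : ℤ, ⟪x, q⟫ = k := by
  induction hq using AddSubgroup.closure_induction with
  | mem y hy =>
    obtain ⟨i, rfl⟩ := hy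
    exact hx i
  | zero => exact ⟨0, by simp⟩
  | add y z _ _ hy hz =>
    obtain ⟨k, hk⟩ := hy
    obtain ⟨l, hl⟩ := hz
    exact ⟨k + l, by rw [inner_add_right, hk, hl]; push_cast; rfl⟩
  | neg y _ hy =>
    obtain ⟨k, hk⟩ := hy
    exact ⟨-k, by rw [inner_neg_right, hk]; push_cast; rfl⟩

lemma root_mem_weightLattice (i : S.ι) : S.R.root i ∈ S.weightLattice :=
  fun _ => S.inner_root_coroot_int _ _

lemma reflection_eq (i : S.ι) (x : EuclideanSpace ℝ (Fin n)) :
    S.R.reflection i x = x - ⟪x, S.R.coroot i⟫ • S.R.root i := by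
  rw [RootPairing.reflection_apply, ← S.pairing_eq]
  rfl

lemma weyl_smul_mem {L : AddSubgroup (EuclideanSpace ℝ (Fin n))}
    (h : ∀ i, ∀ x ∈ L, S.R.reflection i x ∈ L) (w : S.W) {x : EuclideanSpace ℝ (Fin n)}
    (hx : x ∈ L) : w • x ∈ L := by
  obtain ⟨g, hg⟩ := w
  revert x
  induction hg using RootPairing.weylGroup.induction with
  | mem i => exact fun {x} hx => h i x hx
  | one => exact fun {x} hx => hx
  | mul g₁ g₂ hg₁ hg₂ h₁ h₂ => exact fun {x} hx => h₁ (h₂ hx)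

lemma weyl_smul_mem_weightLattice (w : S.W) {x : EuclideanSpace ℝ (Fin n)}
    (hx : x ∈ S.weightLattice) : w • x ∈ S.weightLattice := by
  refine S.weyl_smul_mem (fun i x hx => ?_) w hx
  rw [reflection_eq]
  obtain ⟨k, hk⟩ := S.inner_weight_coroot_int hx (S.coroot_mem_dualRootLattice i)
  rw [hk, Int.cast_smul_eq_zsmul]
  exact sub_mem hx (zsmul_mem (S.root_mem_weightLattice i) k)

lemma weyl_smul_mem_dualRootLattice (w : S.W) {x : EuclideanSpace ℝ (Fin n)}
    (hx : x ∈ S.dualRootLattice) : w • x ∈ S.dualRootLattice := by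
  refine S.weyl_smul_mem (fun i x hx => ?_) w hx
  have e : S.R.reflection i x = x - ⟪S.R.root i, x⟫ • S.R.coroot i := by
    rw [reflection_eq, S.coroot_eq, inner_smul_right, smul_smul, real_inner_comm x]
    ring_nf
  obtain ⟨k, hk⟩ := S.inner_weight_coroot_int (S.root_mem_weightLattice i) hx
  rw [e, hk, Int.cast_smul_eq_zsmul]
  exact sub_mem hx (zsmul_mem (S.coroot_mem_dualRootLattice i) k)

/-- The group `ℝⁿ ⋊ W` of all the maps `T(v)w : a ↦ wa + v`. -/
abbrev AffineMotion : Type :=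
  Multiplicative (EuclideanSpace ℝ (Fin n)) ⋊[
    (MulAutMultiplicative (EuclideanSpace ℝ (Fin n))).symm.toMonoidHom.comp
      (DistribMulAction.toAddAut S.W (EuclideanSpace ℝ (Fin n)))] S.W

/-- The action `T(v)w · a = wa + v`. -/
instance : MulAction S.AffineMotion (EuclideanSpace ℝ (Fin n)) where
  smul g a := g.right • a + g.left.toAdd
  one_smul a := by
    change (1 : S.W) • a + 0 = a
    simp
  mul_smul g h a := by
    change (g.right * h.right) • a + (g.left.toAdd + g.right • h.left.toAdd) =
      g.right • (h.right • a + h.left.toAdd) + g.left.toAdd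
    rw [mul_smul, smul_add, add_assoc, add_comm (g.left.toAdd)]

lemma affine_smul_def (g : S.AffineMotion) (a : EuclideanSpace ℝ (Fin n)) :
    g • a = g.right • a + g.left.toAdd := rfl

/-- The affine Weyl group `W^aff = Q^∨ ⋊ W`. -/
def affineWeylGroup : Subgroup S.AffineMotion where
  carrier := {g | g.left.toAdd ∈ S.dualRootLattice}
  one_mem' := zero_mem S.dualRootLattice
  mul_mem' {g _} hg hh := add_mem hg (S.weyl_smul_mem_dualRootLattice g.right hh)
  inv_mem' {g} hg := S.weyl_smul_mem_dualRootLattice g.right⁻¹ (neg_mem hg)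

/-- The extended dual affine Weyl group `W_P^aff = P ⋊ W`. -/
def extendedDualAffineWeylGroup : Subgroup S.AffineMotion where
  carrier := {g | g.left.toAdd ∈ S.weightLattice}
  one_mem' := zero_mem S.weightLattice
  mul_mem' {g _} hg hh := add_mem hg (S.weyl_smul_mem_weightLattice g.right hh)
  inv_mem' {g} hg := S.weyl_smul_mem_weightLattice g.right⁻¹ (neg_mem hg)

/-- The fundamental domain `F` of `W^aff`. For `a = a₁ω₁^∨ + ⋯ + aₙωₙ^∨` one has
`aᵢ = ⟨a, αᵢ⟩` and `m₁a₁ + ⋯ + mₙaₙ = ⟨a, ξ⟩`, where `mᵢ` are the marks. -/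
def F : Set (EuclideanSpace ℝ (Fin n)) :=
  {a | (∀ i, 0 ≤ ⟪a, S.simpleRoot i⟫) ∧ 0 ≤ 1 - ⟪a, S.highestRoot⟫}

/-- `F^σ`: the points `a` of `F` for which `σ ∘ ψ` is trivial on the stabilizer of `a` in `W^aff`,
where `ψ(T(q)w) = w`. -/
def Fσ (σ : S.W →* ℤˣ) : Set (EuclideanSpace ℝ (Fin n)) :=
  {a ∈ S.F | ∀ g ∈ MulAction.stabilizer S.affineWeylGroup a, σ (g : S.AffineMotion).right = 1}

/-- The Kac coordinates `[b₀, b₁, …, bₙ]` of `b = b₁ω₁ + ⋯ + bₙωₙ`, where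
`bᵢ = ⟨b, αᵢ^∨⟩` and `b₀ = 1 - (m₁^∨b₁ + ⋯ + mₙ^∨bₙ) = 1 - ⟨b, η⟩`. -/
def kac (b : EuclideanSpace ℝ (Fin n)) : Fin (n + 1) → ℝ :=
  Fin.cons (1 - ⟪b, S.highestCoroot⟫) (fun i => ⟪b, S.simpleCoroot i⟫)

/-- The fundamental domain `F_Q` of the dual affine Weyl group `Q ⋊ W`. -/
def FQ : Set (EuclideanSpace ℝ (Fin n)) := {b | ∀ i, 0 ≤ S.kac b i}

/-- The subgroup `Γ` of `W_P^aff` of the elements that leave `F_Q` invariant. -/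
def Γ : Set S.extendedDualAffineWeylGroup := {γ | γ • S.FQ = S.FQ}

/-- The fundamental domain `F_P` of `W_P^aff`: the points of `F_Q` whose Kac coordinates are
lexicographically highest in their `Γ`-orbit. -/
def FP : Set (EuclideanSpace ℝ (Fin n)) :=
  {b ∈ S.FQ | ∀ γ ∈ S.Γ, toLex (S.kac (γ • b)) ≤ toLex (S.kac b)}

/-- `F_P^σ`: the points `b` of `F_P` for which `σ` is trivial on the linear parts of the
stabilizer of `b` in `W_P^aff`. -/
def FPσ (σ : S.W →* ℤˣ) : Set (EuclideanSpace ℝ (Fin n)) :=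
  {b ∈ S.FP | ∀ g ∈ MulAction.stabilizer S.extendedDualAffineWeylGroup b,
    σ (g : S.AffineMotion).right = 1}

/-- The point set `F^σ_{Q^∨,M} = (1/M)Q^∨ ∩ F^σ`. -/
def pointSet (σ : S.W →* ℤˣ) (M : ℕ) : Set (EuclideanSpace ℝ (Fin n)) :=
  ((M : ℝ)⁻¹ • (S.dualRootLattice : Set (EuclideanSpace ℝ (Fin n)))) ∩ S.Fσ σ

/-- The weight set `Λ^σ_{P,M} = P ∩ M F_P^σ`. -/
def weightSet (σ : S.W →* ℤˣ) (M : ℕ) : Set (EuclideanSpace ℝ (Fin n)) :=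
  (S.weightLattice : Set (EuclideanSpace ℝ (Fin n))) ∩ ((M : ℝ) • S.FPσ σ)

/-- `ε(a) = |W| / |Stab_{W^aff}(a)|`. -/
def ε (a : EuclideanSpace ℝ (Fin n)) : ℝ :=
  Nat.card S.W / Nat.card (MulAction.stabilizer S.affineWeylGroup a)

/-- `h_{P,M}(b) = |Stab_{W_P^aff}(b/M)|`. -/
def hPM (M : ℕ) (b : EuclideanSpace ℝ (Fin n)) : ℕ :=
  Nat.card (MulAction.stabilizer S.extendedDualAffineWeylGroup ((M : ℝ)⁻¹ • b))

/-- The Weyl orbit function `φ^σ_b(a) = ∑_{w ∈ W} σ(w) e^{2πi⟨wb, a⟩}`. -/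
def weylOrbit (σ : S.W →* ℤˣ) (b a : EuclideanSpace ℝ (Fin n)) : ℂ :=
  ∑ w : S.W, ((σ w : ℤ) : ℂ) * Complex.exp (2 * Real.pi * Complex.I * (⟪w • b, a⟫ : ℝ))

/-- The Hartley kernel `cas α = cos α + sin α`. -/
def cas (t : ℝ) : ℝ := Real.cos t + Real.sin t

/-- The Hartley orbit function `ζ^σ_b(a) = ∑_{w ∈ W} σ(w) cas(2π⟨wb, a⟩)`. -/
def hartleyOrbit (σ : S.W →* ℤˣ) (b a : EuclideanSpace ℝ (Fin n)) : ℝ :=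
  ∑ w : S.W, ((σ w : ℤ) : ℝ) * cas (2 * Real.pi * ⟪w • b, a⟫)

lemma hartleyOrbit_eq (σ : S.W →* ℤˣ) (b a : EuclideanSpace ℝ (Fin n)) :
    S.hartleyOrbit σ b a = (S.weylOrbit σ b a).re + (S.weylOrbit σ b a).im := by
  rw [hartleyOrbit, weylOrbit, Complex.re_sum, Complex.im_sum, ← Finset.sum_add_distrib]
  refine Finset.sum_congr rfl fun w _ => ?_
  have e : (2 * Real.pi * Complex.I * (⟪w • b, a⟫ : ℝ) : ℂ) =
      ((2 * Real.pi * ⟪w • b, a⟫ : ℝ) : ℂ) * Complex.I := by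
    push_cast
    ring
  have e2 : ((σ w : ℤ) : ℂ) = (((σ w : ℤ) : ℝ) : ℂ) := by push_cast; rfl
  rw [e, e2, Complex.re_ofReal_mul, Complex.im_ofReal_mul, Complex.exp_ofReal_mul_I_re,
    Complex.exp_ofReal_mul_I_im, cas, mul_add]

lemma finite_pointSet (σ : S.W →* ℤˣ) (M : ℕ) : (S.pointSet σ M).Finite := by
  have hinj : Function.Injective
      (fun (a : EuclideanSpace ℝ (Fin n)) (i : Fin n) => ⟪a, S.simpleRoot i⟫) := by
    intro a b hab
    have h : ∀ i ∈ S.base.support, ⟪S.R.root i, a - b⟫ = 0 := by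
      intro i hi
      have := congrFun hab (S.numbering.symm ⟨i, hi⟩)
      simp only [simpleRoot, Equiv.apply_symm_apply] at this
      rw [inner_sub_right, real_inner_comm, this, real_inner_comm, sub_self]
    have h2 : a - b ∈ (⊤ : Submodule ℝ (EuclideanSpace ℝ (Fin n)))ᗮ := by
      rw [← RootPairing.IsRootSystem.span_root_eq_top (P := S.R), ← RootPairing.rootSpan,
        ← S.base.span_root_support, Submodule.mem_orthogonal]
      intro u hu
      induction hu using Submodule.span_induction with
      | mem x hx =>
        obtain ⟨i, hi, rfl⟩ := hx
        exact h i hi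
      | zero => simp
      | add x y _ _ hx hy => rw [inner_add_left, hx, hy, add_zero]
      | smul c x _ hx => rw [inner_smul_left, hx, mul_zero]
    rw [Submodule.top_orthogonal_eq_bot, Submodule.mem_bot] at h2
    exact sub_eq_zero.mp h2
  have hfin : (Set.pi Set.univ fun _ : Fin n =>
      (fun k : ℤ => (M : ℝ)⁻¹ * k) '' Set.Icc (0 : ℤ) M).Finite :=
    Set.Finite.pi fun _ => (Set.finite_Icc _ _).image _
  refine (hfin.preimage hinj.injOn).subset ?_
  rintro s ⟨⟨q, hq, rfl⟩, hs, -⟩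
  rw [Set.mem_preimage, Set.mem_univ_pi]
  intro i
  dsimp only at hs ⊢
  obtain ⟨k, hk⟩ := S.inner_weight_coroot_int (S.root_mem_weightLattice (S.numbering i)) hq
  have hk' : ⟪q, S.simpleRoot i⟫ = k := by rw [real_inner_comm]; exact hk
  have h0 : 0 ≤ (M : ℝ)⁻¹ * k := by
    have := hs.1 i
    rwa [real_inner_smul_left, hk'] at this
  have h1 : (M : ℝ)⁻¹ * k ≤ 1 := by
    have hle : 0 ≤ ⟪(M : ℝ)⁻¹ • q, S.highestRoot - S.simpleRoot i⟫ := by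
      have := S.highestRoot_sub_mem (S.numbering i)
      change S.highestRoot - S.simpleRoot i ∈ _ at this
      generalize S.highestRoot - S.simpleRoot i = v at this
      induction this using AddSubmonoid.closure_induction with
      | mem x hx =>
        obtain ⟨j, rfl⟩ := hx
        exact hs.1 j
      | zero => simp
      | add x y _ _ hx hy => rw [inner_add_right]; exact add_nonneg hx hy
    have h2 := hs.2
    rw [inner_sub_right, real_inner_smul_left _ (S.simpleRoot i), hk'] at hle
    linarith
  rcases Nat.eq_zero_or_pos M with rfl | hM
  · exact ⟨0, by simp, by simp⟩
  · have hM' : (0 : ℝ) < M := by exact_mod_cast hM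
    refine ⟨k, ⟨?_, ?_⟩, ?_⟩
    · have := (mul_nonneg_iff_of_pos_left (inv_pos.mpr hM')).mp h0
      exact_mod_cast this
    · rw [inv_mul_le_iff₀ hM', mul_one] at h1
      exact_mod_cast h1
    · dsimp only
      rw [real_inner_smul_left, hk']

instance (σ : S.W →* ℤˣ) (M : ℕ) : Fintype (S.pointSet σ M) := (S.finite_pointSet σ M).fintype

/-- The scalar product `⟨f, g⟩_M^σ = ∑ ε(s) f(s) conj(g(s))` over the points `s` of the point set
`F^σ_{Q^∨,M}`. -/
def scalarProduct (σ : S.W →* ℤˣ) (M : ℕ) (f g : S.pointSet σ M → ℂ) : ℂ :=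
  ∑ s : S.pointSet σ M, (S.ε s : ℂ) * f s * (starRingEnd ℂ) (g s)

end SimpleRootSystem

end

/-! The weights `ε` unfold the sum over `F^σ_{Q^∨,M}` into a sum over the finite group (1/M)Q^∨/Q^∨
(`sum_pointSet`). This works because the product of two Hartley functions is invariant under W^aff
(the two signs σ(w) cancel) and vanishes at points of F outside F^σ, and because F meets each
W^aff-orbit in exactly one point.

On that group, cas s · cas t = cos(s - t) + sin(s + t). A character sum over (1/M)Q^∨/Q^∨ is M^n or
0, hence real: the sine part always drops out, and the cosine part tests whether (wμ - uν)/M lies in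
P. Substituting uw for w leaves |W| M^n ∑_w σ(w), taken over the w with w(μ/M) - ν/M ∈ P
(`sum_hartleyOrbit_mul`). Such w are the linear parts of the elements of W_P^aff carrying μ/M to
ν/M. Both points lie in F_P, which meets each orbit at most once (`eq_of_mem_FP`), so there are none
unless μ = ν. If μ = ν, they form the stabilizer of μ/M, on which σ is 1 by definition of F_P^σ, and
their number is h_{P,M}(μ).

The remaining work is the geometry of the fundamental domains. It is needed twice, for roots with
lattice Q^∨ and for dual roots with lattice Q, so it is done once for a `ReflectionDatum`. Existence
of a representative in the alcove comes from minimizing the distance to an interior point: a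
separating wall would allow a reflection bringing the image nearer. Uniqueness applies the same
minimization to the motions with a prescribed effect on the point, and rests on the freeness of the
action on alcoves. Freeness of the translations comes from the absence of nonzero minuscule vectors
in the lattice, freeness of W from the exchange property. -/

/-- A finite reflection group `W` acting on a Euclidean space by isometries, presented by
linear forms `⟪·, φ i⟫` and reflection vectors `τ i`, with the positive system spanned by a simple
subsystem and a highest form `φ top`. -/
structure ReflectionDatum (W E ι κ : Type*) [Group W] [NormedAddCommGroup E]
    [InnerProductSpace ℝ E] [DistribMulAction W E] where
  φ : ι → E
  τ : ι → E
  simple : κ → ι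
  top : ι
  s : ι → W
  s_smul : ∀ i (x : E), s i • x = x - ⟪x, φ i⟫ • τ i
  inner_self : ∀ i, ⟪τ i, φ i⟫ = 2
  inner_int : ∀ i j, ∃ k : ℤ, ⟪τ i, φ j⟫ = k
  τ_eq : ∀ i, ∃ c : ℝ, 0 < c ∧ τ i = c • φ i
  smul_φ : ∀ (w : W) i, ∃ j, w • φ i = φ j
  inner_smul : ∀ (w : W) (x y : E), ⟪w • x, w • y⟫ = ⟪x, y⟫
  smul_real : ∀ (w : W) (a : ℝ) (x : E), w • (a • x) = a • (w • x)
  pos_or_neg : ∀ i, φ i ∈ AddSubmonoid.closure (Set.range (φ ∘ simple)) ∨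
    -φ i ∈ AddSubmonoid.closure (Set.range (φ ∘ simple))
  basis : Module.Basis κ ℝ E
  basis_eq : ∀ k, basis k = τ (simple k)
  τ_mem : ∀ i, τ i ∈ AddSubgroup.closure (Set.range (τ ∘ simple))
  top_sub : ∀ i, φ top - φ i ∈ AddSubmonoid.closure (Set.range (φ ∘ simple))
  closure_simple : Subgroup.closure (Set.range (s ∘ simple)) = ⊤
  smul_faithful : ∀ w : W, (∀ x : E, w • x = x) → w = 1

/-! ### Strips, lattices and the fundamental alcove. -/

namespace ReflectionDatum

variable {W E ι κ : Type*} [Group W] [NormedAddCommGroup E] [InnerProductSpace ℝ E]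
  [DistribMulAction W E] (D : ReflectionDatum W E ι κ)

/-- The form `φ i` is positive. -/
def IsPos (i : ι) : Prop := D.φ i ∈ AddSubmonoid.closure (Set.range (D.φ ∘ D.simple))

/-- The lattice spanned by the vectors `τ`. -/
def L : AddSubgroup E := AddSubgroup.closure (Set.range (D.τ ∘ D.simple))

/-- The lattice of vectors on which all simple forms are integral. -/
def P : AddSubgroup E where
  carrier := {x | ∀ k, ∃ m : ℤ, ⟪x, D.φ (D.simple k)⟫ = m}
  zero_mem' i := ⟨0, by simp⟩
  add_mem' {x y} hx hy i := by
    obtain ⟨k, hk⟩ := hx i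
    obtain ⟨l, hl⟩ := hy i
    exact ⟨k + l, by rw [inner_add_left, hk, hl]; push_cast; rfl⟩
  neg_mem' {x} hx i := by
    obtain ⟨k, hk⟩ := hx i
    exact ⟨-k, by rw [inner_neg_left, hk]; push_cast; rfl⟩

/-- The closed fundamental alcove. -/
def alcove : Set E := {x | (∀ k, 0 ≤ ⟪x, D.φ (D.simple k)⟫) ∧ ⟪x, D.φ D.top⟫ ≤ 1}

/-- The interior of the fundamental alcove. -/
def openAlcove : Set E := {x | (∀ k, 0 < ⟪x, D.φ (D.simple k)⟫) ∧ ⟪x, D.φ D.top⟫ < 1}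

lemma openAlcove_subset : D.openAlcove ⊆ D.alcove :=
  fun _ hx => ⟨fun k => (hx.1 k).le, hx.2.le⟩

lemma φ_ne_zero (i : ι) : D.φ i ≠ 0 := by
  intro h
  have := D.inner_self i
  rw [h, inner_zero_right] at this
  norm_num at this

lemma isPos_simple (k : κ) : D.IsPos (D.simple k) := AddSubmonoid.subset_closure ⟨k, rfl⟩

lemma inner_nonneg_of_mem_closure {x y : E} (hx : ∀ k, 0 ≤ ⟪x, D.φ (D.simple k)⟫)
    (hy : y ∈ AddSubmonoid.closure (Set.range (D.φ ∘ D.simple))) : 0 ≤ ⟪x, y⟫ := by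
  induction hy using AddSubmonoid.closure_induction with
  | mem y hy => obtain ⟨k, rfl⟩ := hy; exact hx k
  | zero => simp
  | add y z _ _ hy hz => rw [inner_add_right]; exact add_nonneg hy hz

lemma inner_pos_of_mem_closure {x y : E} (hx : ∀ k, 0 < ⟪x, D.φ (D.simple k)⟫)
    (hy : y ∈ AddSubmonoid.closure (Set.range (D.φ ∘ D.simple))) : y = 0 ∨ 0 < ⟪x, y⟫ := by
  induction hy using AddSubmonoid.closure_induction with
  | mem y hy => obtain ⟨k, rfl⟩ := hy; exact .inr (hx k)
  | zero => simp
  | add y z _ _ hy hz =>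
    rcases hy with rfl | hy
    · simpa using hz
    rcases hz with rfl | hz
    · simpa using .inr hy
    · rw [inner_add_right]; exact .inr (add_pos hy hz)

lemma inner_le_top {x : E} (hx : x ∈ D.alcove) (i : ι) : ⟪x, D.φ i⟫ ≤ ⟪x, D.φ D.top⟫ := by
  have := D.inner_nonneg_of_mem_closure hx.1 (D.top_sub i)
  rw [inner_sub_right] at this
  linarith

lemma inner_mem_Icc {x : E} (hx : x ∈ D.alcove) {i : ι} (hi : D.IsPos i) :
    0 ≤ ⟪x, D.φ i⟫ ∧ ⟪x, D.φ i⟫ ≤ 1 :=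
  ⟨D.inner_nonneg_of_mem_closure hx.1 hi, (D.inner_le_top hx i).trans hx.2⟩

lemma inner_mem_Ioo {x : E} (hx : x ∈ D.openAlcove) {i : ι} (hi : D.IsPos i) :
    0 < ⟪x, D.φ i⟫ ∧ ⟪x, D.φ i⟫ < 1 :=
  ⟨(D.inner_pos_of_mem_closure hx.1 hi).resolve_left (D.φ_ne_zero i),
    (D.inner_le_top (D.openAlcove_subset hx) i).trans_lt hx.2⟩

/-- The reflection `s i` sends `φ i` to its negative, and `W` permutes the forms. -/
lemma exists_neg (i : ι) : ∃ j, D.φ j = -D.φ i := by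
  obtain ⟨j, hj⟩ := D.smul_φ (D.s i) i
  obtain ⟨c, hc, h⟩ := D.τ_eq i
  have h2 := D.inner_self i
  refine ⟨j, ?_⟩
  rw [← hj, D.s_smul, h, smul_smul, real_inner_self_eq_norm_sq]
  rw [h, real_inner_smul_left, real_inner_self_eq_norm_sq, mul_comm] at h2
  rw [h2]
  module

/-- For each form `φ i` there is a strip `[m, m + 1]` containing the alcove. -/
lemma exists_strip (i : ι) : ∃ m : ℤ,
    (∀ x ∈ D.alcove, (m : ℝ) ≤ ⟪x, D.φ i⟫ ∧ ⟪x, D.φ i⟫ ≤ m + 1) ∧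
    (∀ x ∈ D.openAlcove, (m : ℝ) < ⟪x, D.φ i⟫ ∧ ⟪x, D.φ i⟫ < m + 1) := by
  rcases D.pos_or_neg i with h | h
  · refine ⟨0, fun x hx => ?_, fun x hx => ?_⟩
    · simpa using D.inner_mem_Icc hx h
    · simpa using D.inner_mem_Ioo hx h
  · obtain ⟨j, hj⟩ := D.exists_neg i
    have h' : D.IsPos j := by rw [IsPos, hj]; exact h
    refine ⟨-1, fun x hx => ?_, fun x hx => ?_⟩
    · have := D.inner_mem_Icc hx h'
      rw [hj, inner_neg_right] at this
      push_cast
      constructor <;> linarith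
    · have := D.inner_mem_Ioo hx h'
      rw [hj, inner_neg_right] at this
      push_cast
      constructor <;> linarith

lemma zero_mem_alcove : (0 : E) ∈ D.alcove := by simp [alcove]

lemma inner_int_of_mem_closure {x y : E} (hx : x ∈ D.P)
    (hy : y ∈ AddSubmonoid.closure (Set.range (D.φ ∘ D.simple))) : ∃ m : ℤ, ⟪x, y⟫ = m := by
  induction hy using AddSubmonoid.closure_induction with
  | mem y hy => obtain ⟨k, rfl⟩ := hy; exact hx k
  | zero => exact ⟨0, by simp⟩
  | add y z _ _ hy hz =>
    obtain ⟨a, ha⟩ := hy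
    obtain ⟨b, hb⟩ := hz
    exact ⟨a + b, by rw [inner_add_right, ha, hb]; push_cast; rfl⟩

lemma inner_int_of_mem_P {x : E} (hx : x ∈ D.P) (i : ι) : ∃ m : ℤ, ⟪x, D.φ i⟫ = m := by
  rcases D.pos_or_neg i with h | h
  · exact D.inner_int_of_mem_closure hx h
  · obtain ⟨m, hm⟩ := D.inner_int_of_mem_closure hx h
    exact ⟨-m, by rw [inner_neg_right] at hm; push_cast; linarith⟩

lemma L_le_P : D.L ≤ D.P := by
  rw [L, AddSubgroup.closure_le]
  rintro _ ⟨k, rfl⟩ j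
  exact D.inner_int _ _

lemma smul_inner (D : ReflectionDatum W E ι κ) (w : W) (x y : E) : ⟪w • x, y⟫ = ⟪x, w⁻¹ • y⟫ := by
  rw [← D.inner_smul w x, smul_inv_smul]

lemma s_mul_self (i : ι) : D.s i * D.s i = 1 := by
  refine D.smul_faithful _ fun x => ?_
  rw [mul_smul, D.s_smul, D.s_smul, inner_sub_left, real_inner_smul_left, D.inner_self]
  module

lemma s_inv (i : ι) : (D.s i)⁻¹ = D.s i := inv_eq_of_mul_eq_one_left (D.s_mul_self i)

/-- All forms are integral on the lattice, so a reflection changes a lattice vector by an integer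
multiple of some `τ i`. -/
lemma smul_mem_L (w : W) {x : E} (hx : x ∈ D.L) : w • x ∈ D.L := by
  have hw : w ∈ Subgroup.closure (Set.range (D.s ∘ D.simple)) := by
    rw [D.closure_simple]; trivial
  have key (i : ι) (x : E) (hx : x ∈ D.L) : D.s i • x ∈ D.L := by
    obtain ⟨m, hm⟩ := D.inner_int_of_mem_P (D.L_le_P hx) i
    rw [D.s_smul, hm, Int.cast_smul_eq_zsmul]
    exact sub_mem hx (zsmul_mem (D.τ_mem i) m)
  induction hw using Subgroup.closure_induction'' generalizing x with
  | one => simpa using hx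
  | mem w hw => obtain ⟨k, rfl⟩ := hw; exact key _ _ hx
  | inv_mem w hw => obtain ⟨k, rfl⟩ := hw; rw [Function.comp_apply, D.s_inv]; exact key _ _ hx
  | mul v w _ _ hv hw => rw [mul_smul]; exact hv (hw hx)

/-- For each affine motion with translation part in `P`, the image of the alcove lies in a strip
`[m, m + 1]` for each form. -/
lemma exists_strip_affine (w : W) {v : E} (hv : v ∈ D.P) (i : ι) : ∃ m : ℤ,
    (∀ x ∈ D.alcove, (m : ℝ) ≤ ⟪w • x + v, D.φ i⟫ ∧ ⟪w • x + v, D.φ i⟫ ≤ m + 1) ∧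
    (∀ x ∈ D.openAlcove, (m : ℝ) < ⟪w • x + v, D.φ i⟫ ∧ ⟪w • x + v, D.φ i⟫ < m + 1) := by
  obtain ⟨j, hj⟩ := D.smul_φ w⁻¹ i
  obtain ⟨m, hm, hm'⟩ := D.exists_strip j
  obtain ⟨a, ha⟩ := D.inner_int_of_mem_P hv i
  refine ⟨m + a, fun x hx => ?_, fun x hx => ?_⟩
  · rw [inner_add_left, D.smul_inner, hj, ha]
    push_cast
    have := hm x hx
    constructor <;> linarith
  · rw [inner_add_left, D.smul_inner, hj, ha]
    push_cast
    have := hm' x hx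
    constructor <;> linarith

/-- An affine motion whose translation part lies in `P` and which maps one interior point of the
alcove into the alcove maps the alcove and its interior into themselves. -/
lemma maps_alcove {w : W} {v c : E} (hv : v ∈ D.P) (hc : c ∈ D.openAlcove)
    (h : w • c + v ∈ D.alcove) :
    (∀ x ∈ D.alcove, w • x + v ∈ D.alcove) ∧ (∀ x ∈ D.openAlcove, w • x + v ∈ D.openAlcove) := by
  -- The image of the alcove crosses no hyperplane on which a form is an integer, so the strip of
  -- the image of `c` serves for all points. The strict inequalities at `c` force this strip to have
  -- lower end at least 0 for a simple form and upper end at most 1 for the top form.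
  have key := D.exists_strip_affine w hv
  have h1 (k : κ) : ∃ m : ℤ, 0 ≤ m ∧
      (∀ x ∈ D.alcove, (m : ℝ) ≤ ⟪w • x + v, D.φ (D.simple k)⟫) ∧
      (∀ x ∈ D.openAlcove, (m : ℝ) < ⟪w • x + v, D.φ (D.simple k)⟫) := by
    obtain ⟨m, hm, hm'⟩ := key (D.simple k)
    refine ⟨m, ?_, fun x hx => (hm x hx).1, fun x hx => (hm' x hx).1⟩
    have := h.1 k
    have h2 := (hm' c hc).2
    have h3 : (0 : ℝ) < ((m + 1 : ℤ) : ℝ) := by push_cast; linarith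
    have := Int.cast_pos.mp h3
    omega
  obtain ⟨m, hm, hm'⟩ := key D.top
  have h2 : m + 1 ≤ 1 := by
    have h3 : (m : ℝ) < ((1 : ℤ) : ℝ) := by push_cast; linarith [h.2, (hm' c hc).1]
    have := Int.cast_lt.mp h3
    omega
  have h2' : (m : ℝ) + 1 ≤ 1 := by exact_mod_cast h2
  refine ⟨fun x hx => ⟨fun k => ?_, ?_⟩, fun x hx => ⟨fun k => ?_, ?_⟩⟩
  · obtain ⟨a, ha, ha', -⟩ := h1 k
    have : (0 : ℝ) ≤ a := by exact_mod_cast ha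
    linarith [ha' x hx]
  · linarith [(hm x hx).2]
  · obtain ⟨a, ha, -, ha'⟩ := h1 k
    have : (0 : ℝ) ≤ a := by exact_mod_cast ha
    linarith [ha' x hx]
  · linarith [(hm' x hx).2]

/-- The vector pairing to 1 with every simple `τ` is positive on the simple forms; shrinking it
brings the top form below 1. -/
lemma exists_mem_openAlcove [FiniteDimensional ℝ E] : D.openAlcove.Nonempty := by
  let f : StrongDual ℝ E := (D.basis.constr ℝ (fun _ => (1 : ℝ))).toContinuousLinearMap
  let c : E := (InnerProductSpace.toDual ℝ E).symm f
  have hc (k : κ) : ⟪c, D.τ (D.simple k)⟫ = 1 := by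
    rw [InnerProductSpace.toDual_symm_apply, ← D.basis_eq]
    simp [f]
  have hc' (k : κ) : 0 < ⟪c, D.φ (D.simple k)⟫ := by
    obtain ⟨a, ha, h⟩ := D.τ_eq (D.simple k)
    have := hc k
    rw [h, inner_smul_right] at this
    by_contra! h0
    nlinarith
  let t : ℝ := (1 + |⟪c, D.φ D.top⟫|)⁻¹
  have ht : 0 < t := by positivity
  refine ⟨t • c, fun k => ?_, ?_⟩
  · rw [real_inner_smul_left]
    exact mul_pos ht (hc' k)
  · rw [real_inner_smul_left, inv_mul_lt_iff₀ (by positivity)]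
    linarith [le_abs_self ⟪c, D.φ D.top⟫]

end ReflectionDatum

/-! ### Moving points into the alcove; minuscule lattice vectors. -/

namespace ReflectionDatum

variable {W E ι κ : Type*} [Group W] [NormedAddCommGroup E] [InnerProductSpace ℝ E]
  [DistribMulAction W E] (D : ReflectionDatum W E ι κ)

lemma weyl_norm_smul (D : ReflectionDatum W E ι κ) (w : W) (x : E) : ‖w • x‖ = ‖x‖ := by
  rw [norm_eq_sqrt_real_inner, D.inner_smul, ← norm_eq_sqrt_real_inner]

/-- Reflecting a point in an affine hyperplane which separates it from `c` brings it nearer to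
`c`. -/
lemma norm_reflect_lt {i : ι} {m : ℤ} {y c : E}
    (h : 0 < (⟪y, D.φ i⟫ - m) * (m - ⟪c, D.φ i⟫)) :
    ‖D.s i • y + m • D.τ i - c‖ < ‖y - c‖ := by
  obtain ⟨γ, hγ, hτ⟩ := D.τ_eq i
  have h2 := D.inner_self i
  have e : D.s i • y + m • D.τ i - c = (y - c) - (⟪y, D.φ i⟫ - m) • D.τ i := by
    rw [D.s_smul, ← Int.cast_smul_eq_zsmul ℝ]
    module
  have e1 : ⟪y - c, D.τ i⟫ = γ * (⟪y, D.φ i⟫ - ⟪c, D.φ i⟫) := by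
    rw [hτ, inner_smul_right, inner_sub_left]
  have e2 : ⟪D.τ i, D.τ i⟫ = 2 * γ := by
    nth_rewrite 2 [hτ]
    rw [inner_smul_right, h2, mul_comm]
  -- The squared distance drops by exactly 2γ times the product in `h`.
  refine lt_of_pow_lt_pow_left₀ 2 (norm_nonneg _) ?_
  rw [e, norm_sub_sq_real, inner_smul_right, ← real_inner_self_eq_norm_sq (_ • D.τ i),
    inner_smul_right, real_inner_smul_left, e1, e2]
  nlinarith [mul_pos hγ h]

/-- A point outside the alcove is separated from the interior by a wall. -/
lemma exists_wall {c y : E} (hc : c ∈ D.openAlcove) (hy : y ∉ D.alcove) : ∃ i, ∃ m : ℤ,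
    (∀ x ∈ D.alcove, (⟪x, D.φ i⟫ - m) * (m - ⟪c, D.φ i⟫) ≤ 0) ∧
    0 < (⟪y, D.φ i⟫ - m) * (m - ⟪c, D.φ i⟫) := by
  by_cases h : ∃ k, ⟪y, D.φ (D.simple k)⟫ < 0
  · obtain ⟨k, hk⟩ := h
    refine ⟨D.simple k, 0, fun x hx => ?_, ?_⟩
    · have h1 := hx.1 k
      have h2 := hc.1 k
      push_cast
      nlinarith [mul_nonneg h1 h2.le]
    · have h2 := hc.1 k
      push_cast
      nlinarith [mul_pos (neg_pos.mpr hk) h2]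
  · push Not at h
    have h3 : 1 < ⟪y, D.φ D.top⟫ := by
      by_contra! h4
      exact hy ⟨h, h4⟩
    refine ⟨D.top, 1, fun x hx => ?_, ?_⟩
    · have h1 := hx.2
      have h2 := hc.2
      push_cast
      exact mul_nonpos_of_nonpos_of_nonneg (by linarith) (by linarith)
    · have h2 := hc.2
      push_cast
      exact mul_pos (by linarith) (by linarith)

/-- Makes the discreteness of ℤ-spans of bases available for the finiteness argument in
`exists_nearest`. -/
lemma L_eq_span : (D.L : Set E) = Submodule.span ℤ (Set.range D.basis) := by
  have : D.τ ∘ D.simple = D.basis := by ext1 k; exact (D.basis_eq k).symm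
  rw [L, this, ← AddSubgroup.toIntSubmodule_closure]
  rfl

/-- Among affine motions with translation part in the lattice there is one which moves a given
point nearest to another one. -/
lemma exists_nearest [Finite W] [Finite κ] [FiniteDimensional ℝ E] {T : Set (W × E)}
    (hT : T.Nonempty) (hL : ∀ g ∈ T, g.2 ∈ D.L) (y c : E) :
    ∃ g ∈ T, ∀ h ∈ T, ‖g.1 • y + g.2 - c‖ ≤ ‖h.1 • y + h.2 - c‖ := by
  obtain ⟨g₀, hg₀⟩ := hT
  -- Only finitely many motions compete with `g₀`: since `W` acts by isometries, a bound on the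
  -- distance bounds the translation part, and the lattice is discrete.
  have hfin : (T ∩ {g | ‖g.1 • y + g.2 - c‖ ≤ ‖g₀.1 • y + g₀.2 - c‖}).Finite := by
    refine (Set.finite_univ.prod (ZSpan.setFinite_inter D.basis
      (Metric.isBounded_closedBall (x := (0 : E))
        (r := ‖g₀.1 • y + g₀.2 - c‖ + ‖c‖ + ‖y‖)))).subset ?_
    rintro g ⟨hg, hle⟩
    refine ⟨trivial, ?_, ?_⟩
    · rw [mem_closedBall_zero_iff]
      have e : g.2 = (g.1 • y + g.2 - c) + c - g.1 • y := by abel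
      rw [e]
      refine (norm_sub_le _ _).trans ?_
      rw [D.weyl_norm_smul]
      gcongr
      refine (norm_add_le _ _).trans ?_
      gcongr
      exact hle
    · rw [← L_eq_span]
      exact hL g hg
  obtain ⟨g, hg, hmin⟩ := Set.exists_min_image _ (fun g : W × E => ‖g.1 • y + g.2 - c‖) hfin
    ⟨g₀, hg₀, le_refl ‖g₀.1 • y + g₀.2 - c‖⟩
  refine ⟨g, hg.1, fun h hh => ?_⟩
  rcases le_total ‖h.1 • y + h.2 - c‖ ‖g₀.1 • y + g₀.2 - c‖ with h1 | h1
  · exact hmin h ⟨hh, h1⟩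
  · exact hg.2.trans h1

lemma reflect_motion (i : ι) (m : ℤ) (w : W) (v x : E) :
    (D.s i * w) • x + (D.s i • v + m • D.τ i) = D.s i • (w • x + v) + m • D.τ i := by
  rw [mul_smul, smul_add, add_assoc]

lemma reflect_mem_L (i : ι) (m : ℤ) {v : E} (hv : v ∈ D.L) : D.s i • v + m • D.τ i ∈ D.L :=
  add_mem (D.smul_mem_L _ hv) (zsmul_mem (D.τ_mem i) m)

/-- Every point is moved into the alcove by the affine reflection group. -/
theorem exists_motion_mem_alcove [Finite W] [Finite κ] [FiniteDimensional ℝ E] (y : E) :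
    ∃ w : W, ∃ v ∈ D.L, w • y + v ∈ D.alcove := by
  obtain ⟨c, hc⟩ := D.exists_mem_openAlcove
  obtain ⟨⟨w, v⟩, hv, hmin⟩ := D.exists_nearest (T := {g | g.2 ∈ D.L}) ⟨(1, 0), zero_mem D.L⟩
    (fun _ h => h) y c
  refine ⟨w, v, hv, ?_⟩
  by_contra hn
  obtain ⟨i, m, -, h⟩ := D.exists_wall hc hn
  have h1 := hmin (D.s i * w, D.s i • v + m • D.τ i) (D.reflect_mem_L i m hv)
  dsimp only at h1
  rw [reflect_motion] at h1
  exact absurd (D.norm_reflect_lt h) (not_lt.mpr h1)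

/-- A lattice vector on which all forms have absolute value at most one vanishes. -/
lemma eq_zero_of_minuscule [Finite κ] {q : E} (hq : q ∈ D.L) (h : ∀ i, |⟪q, D.φ i⟫| ≤ 1) :
    q = 0 := by
  classical
  have := Fintype.ofFinite κ
  obtain ⟨a, rfl⟩ : ∃ a : κ → ℤ, ∑ k, a k • D.basis k = q := by
    rw [← Submodule.mem_span_range_iff_exists_fun ℤ, ← SetLike.mem_coe, ← L_eq_span]
    exact hq
  generalize hN : ∑ k, (a k).natAbs = N
  -- Induction on the sum of the absolute values of the coordinates of `q`.
  induction N using Nat.strongRecOn generalizing a with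
  | ind N ih =>
    set q := ∑ k, a k • D.basis k with hqdef
    by_contra hne
    -- Expanding ⟪q, q⟫ > 0 gives a `k` for which `a k` and the integer m = ⟪q, φ k⟫ have the same
    -- sign. As |m| ≤ 1, m is the sign of `a k`, so the k-th reflection, which subtracts m from `a
    -- k`, shortens `q` and keeps it minuscule.
    have hpos : 0 < ∑ k, a k * ⟪q, D.basis k⟫ := by
      have e : ∑ k, a k * ⟪q, D.basis k⟫ = ⟪q, q⟫ := by
        conv_rhs => rw [hqdef, inner_sum]
        refine Finset.sum_congr rfl fun k _ => ?_
        rw [← Int.cast_smul_eq_zsmul ℝ, inner_smul_right]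
      rw [e]
      exact real_inner_self_pos.mpr hne
    obtain ⟨k, -, hk⟩ := Finset.exists_lt_of_sum_lt (s := Finset.univ) (f := fun _ : κ => (0 : ℝ))
      (by simpa using hpos)
    obtain ⟨m, hm⟩ := D.L_le_P hq k
    obtain ⟨γ, hγ, hτ⟩ := D.τ_eq (D.simple k)
    have hk2 : 0 < a k * m := by
      rw [D.basis_eq, hτ, inner_smul_right, hm] at hk
      have : (0 : ℝ) < γ * ((a k * m : ℤ) : ℝ) := by push_cast; linarith
      exact_mod_cast (pos_iff_pos_of_mul_pos this).mp hγ
    have hm1 : |m| ≤ 1 := by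
      have := h (D.simple k)
      rw [hm] at this
      exact_mod_cast this
    have hrefl : D.s (D.simple k) • q = ∑ j, (a j - if j = k then m else 0) • D.basis j := by
      rw [D.s_smul, hm, hqdef, ← D.basis_eq, Int.cast_smul_eq_zsmul]
      simp [sub_smul]
    have hlt : ∑ j, (a j - if j = k then m else 0).natAbs < N := by
      rw [← hN]
      refine Finset.sum_lt_sum (fun j _ => ?_) ⟨k, Finset.mem_univ _, ?_⟩
      · split_ifs with hj
        · subst hj
          rw [abs_le] at hm1
          obtain ⟨h1, h2⟩ := hm1
          interval_cases m <;> omega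
        · simp
      · rw [abs_le] at hm1
        obtain ⟨h1, h2⟩ := hm1
        simp only [if_true]
        interval_cases m <;> omega
    have hz := ih _ hlt _ (by rw [← hrefl]; exact D.smul_mem_L _ hq) (fun i => by
      obtain ⟨j, hj⟩ := D.smul_φ (D.s (D.simple k))⁻¹ i
      rw [← hrefl, D.smul_inner, hj]
      exact h j) rfl
    rw [← hrefl, smul_eq_zero_iff_eq] at hz
    exact hne hz

/-! ### Positive forms, words in simple reflections and the exchange property. -/

lemma repr_nonneg {y : E} (hy : y ∈ AddSubmonoid.closure (Set.range (D.φ ∘ D.simple))) (l : κ) :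
    0 ≤ D.basis.repr y l := by
  classical
  induction hy using AddSubmonoid.closure_induction with
  | mem y hy =>
    obtain ⟨k, rfl⟩ := hy
    obtain ⟨γ, hγ, hτ⟩ := D.τ_eq (D.simple k)
    have e : D.φ (D.simple k) = γ⁻¹ • D.basis k := by
      rw [D.basis_eq, hτ, smul_smul, inv_mul_cancel₀ hγ.ne', one_smul]
    rw [Function.comp_apply, e, map_smul, D.basis.repr_self, Finsupp.smul_apply,
      Finsupp.single_apply]
    split_ifs <;> simp [hγ.le]
  | zero => simp
  | add y z _ _ hy hz => rw [map_add, Finsupp.add_apply]; exact add_nonneg hy hz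

lemma not_neg_mem_of_isPos {i : ι} (hi : D.IsPos i) :
    -D.φ i ∉ AddSubmonoid.closure (Set.range (D.φ ∘ D.simple)) := by
  intro h
  refine D.φ_ne_zero i (D.basis.ext_elem fun l => ?_)
  have h1 := D.repr_nonneg hi l
  have h2 := D.repr_nonneg h l
  rw [map_neg, Finsupp.neg_apply] at h2
  rw [map_zero, Finsupp.zero_apply]
  linarith

/-- A simple reflection only makes multiples of its simple form negative. -/
lemma eq_smul_simple {j : ι} {k : κ} (hj : D.IsPos j)
    (h : -(D.s (D.simple k) • D.φ j) ∈ AddSubmonoid.closure (Set.range (D.φ ∘ D.simple))) :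
    ∃ a : ℝ, D.φ j = a • D.φ (D.simple k) := by
  classical
  obtain ⟨γ, hγ, hτ⟩ := D.τ_eq (D.simple k)
  refine ⟨D.basis.repr (D.φ j) k * γ, ?_⟩
  rw [mul_smul, ← hτ, ← D.basis_eq]
  refine D.basis.ext_elem fun l => ?_
  rw [map_smul, D.basis.repr_self, Finsupp.smul_apply, Finsupp.single_apply]
  split_ifs with hl
  · simp [hl]
  -- The reflection alters only the k-th coordinate; any other one is nonnegative for both `φ j` and
  -- the negated image, hence zero.
  · have h1 := D.repr_nonneg hj l
    have h2 := D.repr_nonneg h l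
    rw [D.s_smul, ← D.basis_eq, map_neg, map_sub, map_smul, D.basis.repr_self, Finsupp.neg_apply,
      Finsupp.sub_apply, Finsupp.smul_apply, Finsupp.single_apply, if_neg hl] at h2
    simp only [smul_zero, sub_zero] at h2 ⊢
    linarith

lemma eq_of_smul_eq (D : ReflectionDatum W E ι κ) {v w : W} (h : ∀ x : E, v • x = w • x) :
    v = w := by
  rw [← inv_mul_eq_one]
  exact D.smul_faithful _ fun x => by rw [mul_smul, ← h, inv_smul_smul]

/-- Conjugating a reflection gives the reflection in the image form. Only the line of that form
matters, so a scalar multiple is enough and no reducedness is required. -/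
lemma mul_s_eq {w : W} {i j : ι} {a : ℝ} (h : w • D.φ i = a • D.φ j) :
    w * D.s i = D.s j * w := by
  refine D.eq_of_smul_eq fun x => ?_
  obtain ⟨γ, hγ, hτ⟩ := D.τ_eq i
  obtain ⟨γ', hγ', hτ'⟩ := D.τ_eq j
  have h1 := D.inner_self i
  have h2 := D.inner_self j
  rw [hτ, real_inner_smul_left, ← D.inner_smul w, h, real_inner_smul_left, inner_smul_right] at h1
  rw [hτ', real_inner_smul_left] at h2
  have e : γ' = γ * a * a := by
    have hne : ⟪D.φ j, D.φ j⟫ ≠ 0 := by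
      intro h0
      rw [h0] at h2
      norm_num at h2
    apply mul_right_cancel₀ hne
    linarith
  rw [mul_smul, mul_smul, D.s_smul, D.s_smul, smul_sub, D.smul_real, hτ, D.smul_real, h,
    ← D.inner_smul w x, h, inner_smul_right, hτ', e]
  generalize w • x = z
  module

lemma exists_word (w : W) : ∃ l : List κ, w = (l.map (D.s ∘ D.simple)).prod := by
  have hw : w ∈ Subgroup.closure (Set.range (D.s ∘ D.simple)) := by
    rw [D.closure_simple]; trivial
  induction hw using Subgroup.closure_induction'' with
  | one => exact ⟨[], rfl⟩
  | mem w hw => obtain ⟨k, rfl⟩ := hw; exact ⟨[k], by simp⟩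
  | inv_mem w hw => obtain ⟨k, rfl⟩ := hw; exact ⟨[k], by simp [D.s_inv]⟩
  | mul v w _ _ hv hw =>
    obtain ⟨l, rfl⟩ := hv
    obtain ⟨l', rfl⟩ := hw
    exact ⟨l ++ l', by simp⟩

/-- The exchange property. -/
lemma exists_exchange {i : ι} (hi : D.IsPos i) (l : List κ)
    (h : -((l.map (D.s ∘ D.simple)).prod • D.φ i) ∈
      AddSubmonoid.closure (Set.range (D.φ ∘ D.simple))) :
    ∃ l' : List κ, l'.length < l.length ∧
      (l'.map (D.s ∘ D.simple)).prod = (l.map (D.s ∘ D.simple)).prod * D.s i := by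
  induction l with
  | nil => exact absurd (by simpa using h) (D.not_neg_mem_of_isPos hi)
  | cons t l ih =>
    obtain ⟨j, hj⟩ := D.smul_φ (l.map (D.s ∘ D.simple)).prod i
    rw [List.map_cons, List.prod_cons] at h ⊢
    -- Apply the word to `φ i` from the right. If the image is still positive before the letter `t`,
    -- then `t` turns it negative, the image is a multiple of the form of `t`, and `t` can be
    -- deleted; otherwise the sign changed earlier, inside `l`.
    rcases D.pos_or_neg j with hp | hn
    · rw [mul_smul, hj] at h
      obtain ⟨a, ha⟩ := D.eq_smul_simple hp h
      refine ⟨l, by simp, ?_⟩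
      rw [mul_assoc, D.mul_s_eq (hj.trans ha), ← mul_assoc, Function.comp_apply, D.s_mul_self,
        one_mul]
    · rw [← hj] at hn
      obtain ⟨l', hl', e⟩ := ih hn
      exact ⟨t :: l', by simpa using hl', by rw [List.map_cons, List.prod_cons, e, mul_assoc]⟩

/-- An element which preserves positivity is trivial. -/
lemma eq_one_of_preserves_pos {w : W}
    (h : ∀ k, w • D.φ (D.simple k) ∈ AddSubmonoid.closure (Set.range (D.φ ∘ D.simple))) :
    w = 1 := by
  obtain ⟨l, rfl⟩ := D.exists_word w
  generalize hN : l.length = N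
  induction N using Nat.strongRecOn generalizing l with
  | ind N ih =>
    rcases l.eq_nil_or_concat with rfl | ⟨l₀, t, rfl⟩
    · rfl
    have e : ((l₀.concat t).map (D.s ∘ D.simple)).prod =
        (l₀.map (D.s ∘ D.simple)).prod * D.s (D.simple t) := by simp
    rw [e] at h ⊢
    -- The last reflection negates its own form, so positivity of the image means that `l₀` makes
    -- this form negative. The exchange property then absorbs the last letter and yields a shorter
    -- word for the same element.
    have h1 := h t
    have h2 : D.s (D.simple t) • D.φ (D.simple t) = -D.φ (D.simple t) := by
      obtain ⟨c, hc, h⟩ := D.τ_eq (D.simple t)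
      have h2 := D.inner_self (D.simple t)
      rw [D.s_smul, h, smul_smul, mul_comm, ← real_inner_smul_left, ← h, h2]
      module
    rw [mul_smul, h2, smul_neg] at h1
    obtain ⟨l', hl', e'⟩ := D.exists_exchange (D.isPos_simple t) l₀ h1
    rw [← e'] at h ⊢
    exact ih l'.length (by rw [← hN]; simpa using hl'.trans (Nat.lt_succ_self _)) l' h rfl

/-- The affine reflection group acts freely on alcoves. -/
lemma eq_one_of_maps_alcove [Finite κ] {w : W} {v c : E} (hc : c ∈ D.openAlcove) (hv : v ∈ D.L)
    (h : w • c + v ∈ D.alcove) : w = 1 ∧ v = 0 := by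
  -- The vertex 0 is mapped to `v`, so `v` lies in the alcove and is minuscule.
  have hv0 : v ∈ D.alcove := by
    simpa using (D.maps_alcove (D.L_le_P hv) hc h).1 0 D.zero_mem_alcove
  have hv1 : v = 0 := by
    refine D.eq_zero_of_minuscule hv fun i => ?_
    rcases D.pos_or_neg i with hi | hi
    · have := D.inner_mem_Icc hv0 hi
      exact abs_le.mpr ⟨by linarith, this.2⟩
    · obtain ⟨j, hj⟩ := D.exists_neg i
      have := D.inner_mem_Icc hv0 (i := j) (by rw [IsPos, hj]; exact hi)
      rw [hj, inner_neg_right] at this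
      exact abs_le.mpr ⟨by linarith, by linarith⟩
  refine ⟨?_, hv1⟩
  -- A negative form is strictly negative at `c`, whereas the form w⁻¹φ takes at `c` the value of
  -- the simple form φ at `w • c`, which is nonnegative.
  rw [← inv_eq_one]
  refine D.eq_one_of_preserves_pos fun k => ?_
  obtain ⟨j, hj⟩ := D.smul_φ w⁻¹ (D.simple k)
  rw [hj]
  refine (D.pos_or_neg j).resolve_right fun hn => ?_
  have h1 := D.inner_pos_of_mem_closure hc.1 hn
  rw [neg_eq_zero, inner_neg_right] at h1
  have h2 := h.1 k
  rw [hv1, add_zero, D.smul_inner, hj] at h2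
  have := h1.resolve_left (D.φ_ne_zero j)
  linarith

/-- Two points of the alcove in the same orbit of the affine reflection group coincide. -/
theorem motion_eq_of_mem_alcove [Finite W] [Finite κ] [FiniteDimensional ℝ E] {w : W} {v x : E}
    (hv : v ∈ D.L) (hx : x ∈ D.alcove) (h : w • x + v ∈ D.alcove) : w • x + v = x := by
  obtain ⟨c, hc⟩ := D.exists_mem_openAlcove
  -- Among all motions with the same effect on `x`, take one moving `c` least. If it keeps `c` in
  -- the alcove, it is trivial by freeness.
  obtain ⟨⟨w', v'⟩, ⟨hv', he⟩, hmin⟩ := D.exists_nearest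
    (T := {g | g.2 ∈ D.L ∧ g.1 • x + g.2 = w • x + v}) ⟨(w, v), hv, rfl⟩ (fun _ h => h.1) c c
  dsimp only at hv' he
  rw [← he] at h ⊢
  by_cases hn : w' • c + v' ∈ D.alcove
  · obtain ⟨rfl, rfl⟩ := D.eq_one_of_maps_alcove hc hv' hn
    simp
  exfalso
  obtain ⟨i, m, h1, h2⟩ := D.exists_wall hc hn
  obtain ⟨k, h3, h4⟩ := D.exists_strip_affine w' (D.L_le_P hv') i
  -- The images of `x` and `c` share a strip, and that of `c` lies strictly beyond the wall, so that
  -- of `x` is on the wall or beyond. Being in the alcove, it is on the wall; reflecting fixes it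
  -- and brings the image of `c` nearer to `c`.
  have h5 : ⟪w' • x + v', D.φ i⟫ = m := by
    have h1 := h1 _ h
    have h3 := h3 x hx
    have h4 := h4 c hc
    rcases pos_and_pos_or_neg_and_neg_of_mul_pos h2 with ⟨ha, hb⟩ | ⟨ha, hb⟩
    · have : (m : ℝ) < ((k + 1 : ℤ) : ℝ) := by push_cast; linarith
      have : m ≤ k := Int.lt_add_one_iff.mp (Int.cast_lt.mp this)
      have : (m : ℝ) ≤ k := by exact_mod_cast this
      have := nonpos_of_mul_nonpos_left h1 hb
      linarith
    · have : (k : ℝ) < m := by linarith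
      have : k + 1 ≤ m := Int.cast_lt.mp this
      have : (k : ℝ) + 1 ≤ m := by exact_mod_cast this
      have : 0 ≤ ⟪w' • x + v', D.φ i⟫ - m := by
        by_contra! h0
        have := mul_pos_of_neg_of_neg h0 hb
        linarith
      linarith
  have h6 : D.s i • (w' • x + v') + m • D.τ i = w' • x + v' := by
    rw [D.s_smul, h5, Int.cast_smul_eq_zsmul]
    abel
  have h7 := hmin (D.s i * w', D.s i • v' + m • D.τ i)
    ⟨D.reflect_mem_L i m hv', by rw [reflect_motion, h6, he]⟩
  dsimp only at h7
  rw [reflect_motion] at h7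
  exact absurd (D.norm_reflect_lt h2) (not_lt.mpr h7)

end ReflectionDatum

/-! ### The two reflection data of a root system; the domains F and F_P. -/

namespace SimpleRootSystem

variable {n : ℕ} (S : SimpleRootSystem n)

lemma weyl_eq_one_of_smul {w : S.W} (h : ∀ x : EuclideanSpace ℝ (Fin n), w • x = x) : w = 1 := by
  apply Subtype.ext
  apply RootPairing.Equiv.weightHom_injective
  apply LinearEquiv.toLinearMap_injective
  ext1 x
  exact h x

lemma weyl_ext {v w : S.W} (h : ∀ x : EuclideanSpace ℝ (Fin n), v • x = w • x) : v = w := by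
  rw [← inv_mul_eq_one]
  exact S.weyl_eq_one_of_smul fun x => by rw [mul_smul, ← h, inv_smul_smul]

/-- The reflection in a root, as an element of the Weyl group. -/
abbrev weylReflection (i : S.ι) : S.W := RootPairing.weylGroup.ofIdx S.R i

lemma weylReflection_smul (i : S.ι) (x : EuclideanSpace ℝ (Fin n)) :
    S.weylReflection i • x = S.R.reflection i x := rfl

lemma weylReflection_smul_root (i : S.ι) (x : EuclideanSpace ℝ (Fin n)) :
    S.weylReflection i • x = x - ⟪x, S.R.coroot i⟫ • S.R.root i :=
  S.reflection_eq i x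

lemma weylReflection_smul_coroot (i : S.ι) (x : EuclideanSpace ℝ (Fin n)) :
    S.weylReflection i • x = x - ⟪x, S.R.root i⟫ • S.R.coroot i := by
  rw [weylReflection_smul_root, S.coroot_eq, inner_smul_right, smul_smul, mul_comm]

lemma inner_root_coroot_two (i : S.ι) : ⟪S.R.root i, S.R.coroot i⟫ = 2 := by
  rw [← S.pairing_eq]
  exact S.R.root_coroot_two i

lemma inner_root_self_pos (i : S.ι) : 0 < ⟪S.R.root i, S.R.root i⟫ := by
  have h := S.inner_root_coroot_two i
  refine real_inner_self_pos.mpr fun h0 => ?_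
  rw [h0, inner_zero_left] at h
  norm_num at h

lemma inner_weyl_smul (w : S.W) (x y : EuclideanSpace ℝ (Fin n)) : ⟪w • x, w • y⟫ = ⟪x, y⟫ := by
  obtain ⟨g, hg⟩ := w
  induction hg using RootPairing.weylGroup.induction generalizing x y with
  | mem i =>
    change ⟪S.weylReflection i • x, S.weylReflection i • y⟫ = _
    have h := S.inner_root_coroot_two i
    have h2 := (S.inner_root_self_pos i).ne'
    rw [weylReflection_smul_root, weylReflection_smul_root, S.coroot_eq]
    simp only [inner_sub_left, inner_sub_right, real_inner_smul_left, inner_smul_right]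
    rw [real_inner_comm y (S.R.root i)]
    field_simp
    ring
  | one => rfl
  | mul g₁ g₂ h₁ h₂ ih₁ ih₂ =>
    exact (ih₁ _ _).trans (ih₂ _ _)

lemma weyl_smul_real (w : S.W) (a : ℝ) (x : EuclideanSpace ℝ (Fin n)) :
    w • (a • x) = a • (w • x) := smul_comm w a x

lemma weyl_smul_root (w : S.W) (i : S.ι) :
    w • S.R.root i = S.R.root (S.R.weylGroupToPerm w i) := S.R.weylGroup_apply_root w i

lemma weyl_smul_coroot (w : S.W) (i : S.ι) :
    w • S.R.coroot i = S.R.coroot (S.R.weylGroupToPerm w i) := by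
  rw [S.coroot_eq, S.coroot_eq, weyl_smul_real, ← weyl_smul_root, inner_weyl_smul]

/-- Every root arises from simple ones by simple reflections, and the reflection in the image of αᵢ
under sⱼ is the conjugate sⱼsᵢsⱼ. -/
lemma closure_weylReflection_simple :
    Subgroup.closure (Set.range (S.weylReflection ∘ fun k => (S.numbering k : S.ι))) = ⊤ := by
  set H := Subgroup.closure (Set.range (S.weylReflection ∘ fun k => (S.numbering k : S.ι)))
  have key (i : S.ι) : S.weylReflection i ∈ H := by
    have h1 : ∀ i ∈ S.base.support, S.weylReflection i ∈ H := fun i hi =>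
      Subgroup.subset_closure ⟨S.numbering.symm ⟨i, hi⟩, by simp⟩
    have h2 : ∀ i j, S.weylReflection i ∈ H → S.weylReflection j ∈ H →
        S.weylReflection (S.R.reflectionPerm j i) ∈ H := by
      intro i j hi hj
      have : S.weylReflection (S.R.reflectionPerm j i) =
          S.weylReflection j * S.weylReflection i * S.weylReflection j := by
        refine S.weyl_ext fun x => ?_
        rw [mul_smul, mul_smul, weylReflection_smul, S.R.reflection_reflectionPerm]
        rfl
      rw [this]
      exact mul_mem (mul_mem hj hi) hj
    exact S.base.induction_reflect i (p := fun i => S.weylReflection i ∈ H)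
      (fun i hi => h2 i i hi hi) h1 fun i j hi hj => h2 i j hi (h1 j hj)
  refine eq_top_iff.mpr ?_
  rintro ⟨g, hg⟩ -
  induction hg using RootPairing.weylGroup.induction with
  | mem i => exact key i
  | one => exact one_mem H
  | mul g₁ g₂ h₁ h₂ ih₁ ih₂ => exact mul_mem ih₁ ih₂

lemma range_simpleRoot : S.R.root '' S.base.support = Set.range S.simpleRoot := by
  ext x
  constructor
  · rintro ⟨i, hi, rfl⟩
    exact ⟨S.numbering.symm ⟨i, hi⟩, by simp [simpleRoot]⟩
  · rintro ⟨i, rfl⟩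
    exact ⟨_, (S.numbering i).2, rfl⟩

lemma range_simpleCoroot : S.R.coroot '' S.base.support = Set.range S.simpleCoroot := by
  ext x
  constructor
  · rintro ⟨i, hi, rfl⟩
    exact ⟨S.numbering.symm ⟨i, hi⟩, by simp [simpleCoroot]⟩
  · rintro ⟨i, rfl⟩
    exact ⟨_, (S.numbering i).2, rfl⟩

/-- The reflection datum whose forms are the roots and whose lattice is the dual root lattice. -/
noncomputable def rootDatum :
    ReflectionDatum S.W (EuclideanSpace ℝ (Fin n)) S.ι (Fin n) where
  φ := S.R.root
  τ := S.R.coroot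
  simple k := S.numbering k
  top := (exists_highest_root S.R S.base).choose
  s := S.weylReflection
  s_smul := S.weylReflection_smul_coroot
  inner_self i := by rw [real_inner_comm, inner_root_coroot_two]
  inner_int i j := by rw [real_inner_comm]; exact S.inner_root_coroot_int j i
  τ_eq i := ⟨_, div_pos two_pos (S.inner_root_self_pos i), S.coroot_eq i⟩
  smul_φ w i := ⟨_, S.weyl_smul_root w i⟩
  inner_smul := S.inner_weyl_smul
  smul_real := S.weyl_smul_real
  pos_or_neg i := by
    have := S.base.root_mem_or_neg_mem i
    rwa [range_simpleRoot] at this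
  basis := S.base.toCoweightBasis.reindex S.numbering.symm
  basis_eq k := by simp
  τ_mem := S.coroot_mem_dualRootLattice
  top_sub := S.highestRoot_sub_mem
  closure_simple := S.closure_weylReflection_simple
  smul_faithful _ := S.weyl_eq_one_of_smul

/-- The reflection datum whose forms are the dual roots and whose lattice is the root lattice. -/
noncomputable def corootDatum :
    ReflectionDatum S.W (EuclideanSpace ℝ (Fin n)) S.ι (Fin n) where
  φ := S.R.coroot
  τ := S.R.root
  simple k := S.numbering k
  top := (exists_highest_root S.R.flip S.base.flip).choose
  s := S.weylReflection
  s_smul := S.weylReflection_smul_root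
  inner_self := S.inner_root_coroot_two
  inner_int := S.inner_root_coroot_int
  τ_eq i := by
    have h := S.inner_root_self_pos i
    refine ⟨⟪S.R.root i, S.R.root i⟫ / 2, by positivity, ?_⟩
    rw [S.coroot_eq, smul_smul, div_mul_div_cancel₀ two_ne_zero, div_self h.ne', one_smul]
  smul_φ w i := ⟨_, S.weyl_smul_coroot w i⟩
  inner_smul := S.inner_weyl_smul
  smul_real := S.weyl_smul_real
  pos_or_neg i := by
    have := S.base.coroot_mem_or_neg_mem i
    rwa [range_simpleCoroot] at this
  basis := S.base.toWeightBasis.reindex S.numbering.symm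
  basis_eq k := by simp
  τ_mem i := by
    have h := S.base.root_mem_span_int i
    rwa [range_simpleRoot, ← AddSubgroup.toIntSubmodule_closure] at h
  top_sub := S.highestCoroot_sub_mem
  closure_simple := S.closure_weylReflection_simple
  smul_faithful _ := S.weyl_eq_one_of_smul

lemma rootDatum_alcove : S.rootDatum.alcove = S.F := by
  ext x
  exact and_congr Iff.rfl sub_nonneg.symm

lemma corootDatum_alcove : S.corootDatum.alcove = S.FQ := by
  ext x
  rw [FQ, Set.mem_ofPred_eq, Fin.forall_fin_succ]
  exact (and_congr Iff.rfl sub_nonneg.symm).trans and_comm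

/-- The affine motion `x ↦ w x + v` as an element of `ℝⁿ ⋊ W`. -/
noncomputable def motion (w : S.W) (v : EuclideanSpace ℝ (Fin n)) : S.AffineMotion :=
  ⟨Multiplicative.ofAdd v, w⟩

lemma exists_weyl_mem_F (y : EuclideanSpace ℝ (Fin n)) :
    ∃ w : S.W, ∃ v ∈ S.dualRootLattice, w • y + v ∈ S.F := by
  rw [← rootDatum_alcove]
  exact S.rootDatum.exists_motion_mem_alcove y

lemma eq_of_mem_F {w : S.W} {v x : EuclideanSpace ℝ (Fin n)} (hv : v ∈ S.dualRootLattice)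
    (hx : x ∈ S.F) (h : w • x + v ∈ S.F) : w • x + v = x := by
  rw [← rootDatum_alcove] at hx h
  exact S.rootDatum.motion_eq_of_mem_alcove hv hx h

/-- The dual simple roots form a basis, so b₁, …, bₙ determine b. A lexicographic tie is thereby an
equality of points. -/
lemma kac_injective : Function.Injective S.kac := by
  intro x y h
  rw [← sub_eq_zero]
  have hb : ∀ k, ⟪x - y, S.rootDatum.basis k⟫ = 0 := by
    intro k
    have := congrFun h k.succ
    simp only [kac, Fin.cons_succ] at this
    rw [S.rootDatum.basis_eq, inner_sub_left, sub_eq_zero]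
    exact this
  have h0 : innerₗ (EuclideanSpace ℝ (Fin n)) (x - y) = 0 :=
    S.rootDatum.basis.ext hb
  have h1 : ⟪x - y, x - y⟫ = 0 := LinearMap.congr_fun h0 (x - y)
  exact inner_self_eq_zero.mp h1

/-- Two points of `F_P` in the same orbit of the extended dual affine Weyl group coincide. -/
theorem eq_of_mem_FP {g : S.extendedDualAffineWeylGroup} {b b' : EuclideanSpace ℝ (Fin n)}
    (hb : b ∈ S.FP) (hb' : b' ∈ S.FP) (h : g • b = b') : b = b' := by
  obtain ⟨c, hc⟩ := S.corootDatum.exists_mem_openAlcove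
  -- An element `m` of Q ⋊ W corrects `g` so that `m * g` brings the interior point `c` back into
  -- F_Q. Then `m * g` and its inverse both preserve F_Q, so they lie in Γ.
  obtain ⟨w', v', hv', hw'⟩ := S.corootDatum.exists_motion_mem_alcove (g • c)
  let m : S.extendedDualAffineWeylGroup := ⟨S.motion w' v', S.corootDatum.L_le_P hv'⟩
  have maps (k : S.extendedDualAffineWeylGroup) (c) (hc : c ∈ S.corootDatum.openAlcove)
      (hk : k • c ∈ S.corootDatum.alcove) :
      (∀ x ∈ S.FQ, k • x ∈ S.FQ) ∧ k • c ∈ S.corootDatum.openAlcove := by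
    rw [← corootDatum_alcove]
    have h := S.corootDatum.maps_alcove (w := (k : S.AffineMotion).right) k.2 hc hk
    exact ⟨h.1, h.2 c hc⟩
  obtain ⟨h1, h2⟩ := maps (m * g) c hc (by rw [mul_smul]; exact hw')
  obtain ⟨h3, -⟩ := maps (m * g)⁻¹ _ h2 (by
    rw [inv_smul_smul]; exact S.corootDatum.openAlcove_subset hc)
  have h4 : m * g ∈ S.Γ := by
    refine Set.Subset.antisymm (Set.image_subset_iff.mpr h1) fun x hx => ?_
    rw [Set.mem_smul_set_iff_inv_smul_mem]
    exact h3 x hx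
  have h5 : (m * g)⁻¹ ∈ S.Γ := by
    have : (m * g) • S.FQ = S.FQ := h4
    change (m * g)⁻¹ • S.FQ = S.FQ
    rw [inv_smul_eq_iff, this]
  -- `m` maps `b'` to a point of F_Q, and F_Q meets each orbit of Q ⋊ W once, so `m` fixes `b'`.
  have h6 : (m * g) • b = b' := by
    have h7 := h1 b hb.1
    rw [mul_smul, h] at h7 ⊢
    rw [← corootDatum_alcove] at h7
    exact S.corootDatum.motion_eq_of_mem_alcove hv' (by rw [corootDatum_alcove]; exact hb'.1) h7
  have h8 := hb.2 _ h4
  have h9 := hb'.2 _ h5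
  rw [h6] at h8
  rw [← h6, inv_smul_smul, h6] at h9
  exact S.kac_injective (toLex.injective (le_antisymm h9 h8))

end SimpleRootSystem

/-! ### Stabilizers, character sums on (1/M)Q^∨/Q^∨ and unfolding. -/

lemma sum_fin_pow_eq_zero {M : ℕ} {z : ℂ} (hz : z ^ M = 1) (h1 : z ≠ 1) :
    ∑ j : Fin M, z ^ (j : ℕ) = 0 := by
  rw [Fin.sum_univ_eq_sum_range (fun j => z ^ j), geom_sum_eq h1, hz, sub_self, zero_div]

namespace SimpleRootSystem

variable {n : ℕ} (S : SimpleRootSystem n)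

/-- A motion fixing `a` is determined by its linear part w, since its translation must be a - wa.
Stabilizers thus become subsets of W cut out by a lattice condition. -/
lemma card_stabilizer (L : AddSubgroup (EuclideanSpace ℝ (Fin n))) (G : Subgroup S.AffineMotion)
    (hG : ∀ g, g ∈ G ↔ g.left.toAdd ∈ L) (a : EuclideanSpace ℝ (Fin n)) :
    Nat.card (MulAction.stabilizer G a) = Nat.card {w : S.W // w • a - a ∈ L} := by
  refine Nat.card_congr
    { toFun := fun g => ⟨((g : G) : S.AffineMotion).right, ?_⟩
      invFun := fun w => ⟨⟨S.motion w (a - (w : S.W) • a), ?_⟩, ?_⟩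
      left_inv := ?_
      right_inv := fun w => rfl }
  · have h1 : ((g : G) : S.AffineMotion).right • a + ((g : G) : S.AffineMotion).left.toAdd = a := g.2
    have h2 := (hG _).mp (g : G).2
    have : ((g : G) : S.AffineMotion).right • a - a = -((g : G) : S.AffineMotion).left.toAdd := by
      rw [sub_eq_iff_eq_add', ← sub_eq_add_neg, eq_sub_iff_add_eq, h1]
    rw [this]
    exact neg_mem h2
  · rw [hG]
    have := neg_mem w.2
    rwa [neg_sub] at this
  · change (w : S.W) • a + (a - (w : S.W) • a) = a
    abel
  · rintro ⟨⟨g, hg⟩, hga⟩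
    have h1 : g.right • a + g.left.toAdd = a := hga
    apply Subtype.ext
    apply Subtype.ext
    refine SemidirectProduct.ext ?_ rfl
    change Multiplicative.ofAdd (a - g.right • a) = g.left
    rw [← eq_sub_iff_add_eq'] at h1
    rw [← h1]
    rfl

lemma card_stabilizer_affineWeylGroup (a : EuclideanSpace ℝ (Fin n)) :
    Nat.card (MulAction.stabilizer S.affineWeylGroup a) =
      Nat.card {w : S.W // w • a - a ∈ S.dualRootLattice} :=
  S.card_stabilizer _ _ (fun _ => Iff.rfl) a

lemma hPM_eq (M : ℕ) (b : EuclideanSpace ℝ (Fin n)) :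
    S.hPM M b = Nat.card {w : S.W // w • ((M : ℝ)⁻¹ • b) - (M : ℝ)⁻¹ • b ∈ S.weightLattice} :=
  S.card_stabilizer _ _ (fun _ => Iff.rfl) _

/-- The points `∑ᵢ (kᵢ / M) αᵢ^∨` with `0 ≤ kᵢ < M`, which represent `(1/M)Q^∨ / Q^∨`. -/
noncomputable def gridPoint (M : ℕ) (k : Fin n → Fin M) : EuclideanSpace ℝ (Fin n) :=
  (M : ℝ)⁻¹ • ∑ i, ((k i : ℕ) : ℤ) • S.simpleCoroot i

lemma mem_dualRootLattice_iff {x : EuclideanSpace ℝ (Fin n)} :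
    x ∈ S.dualRootLattice ↔ ∃ a : Fin n → ℤ, ∑ i, a i • S.simpleCoroot i = x := by
  rw [← Submodule.mem_span_range_iff_exists_fun ℤ, ← AddSubgroup.toIntSubmodule_closure]
  rfl

lemma sum_simpleCoroot_inj {a b : Fin n → ℝ}
    (h : ∑ i, a i • S.simpleCoroot i = ∑ i, b i • S.simpleCoroot i) : a = b := by
  have e (a : Fin n → ℝ) : S.rootDatum.basis.repr (∑ i, a i • S.simpleCoroot i) = a := by
    have : ∑ i, a i • S.simpleCoroot i = ∑ i, a i • S.rootDatum.basis i :=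
      Finset.sum_congr rfl fun i _ => by rw [S.rootDatum.basis_eq]; rfl
    rw [this]
    exact S.rootDatum.basis.repr_sum_self a
  rw [← e a, h, e b]

lemma gridPoint_sub_gridPoint {M : ℕ} (hM : 0 < M) {k l : Fin n → Fin M}
    (h : S.gridPoint M k - S.gridPoint M l ∈ S.dualRootLattice) : k = l := by
  obtain ⟨a, ha⟩ := S.mem_dualRootLattice_iff.mp h
  have hM' : (M : ℝ) ≠ 0 := by positivity
  have h1 := S.sum_simpleCoroot_inj (a := fun i => (M : ℝ) * a i)
    (b := fun i => ((k i : ℕ) : ℝ) - ((l i : ℕ) : ℝ)) (by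
      simp only [sub_smul, mul_smul, Finset.sum_sub_distrib, ← Finset.smul_sum]
      simp only [Int.cast_smul_eq_zsmul, ha, gridPoint]
      rw [smul_sub, smul_inv_smul₀ hM', smul_inv_smul₀ hM']
      simp [Nat.cast_smul_eq_nsmul])
  funext i
  have h2 : (M : ℤ) * a i = (k i : ℕ) - (l i : ℕ) := by exact_mod_cast congrFun h1 i
  have hk := (k i).2
  have hl := (l i).2
  apply Fin.ext
  -- Two residues in [0, M) whose difference is a multiple of M coincide.
  have h3 : |(M : ℤ) * a i| < M := by rw [h2, abs_lt]; omega
  have h4 : a i = 0 := by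
    by_contra h0
    rw [abs_mul, Nat.abs_cast] at h3
    have := Int.one_le_abs h0
    nlinarith
  rw [h4] at h2
  omega

lemma exists_gridPoint {M : ℕ} (hM : 0 < M) {q : EuclideanSpace ℝ (Fin n)}
    (hq : q ∈ S.dualRootLattice) :
    ∃ k, (M : ℝ)⁻¹ • q - S.gridPoint M k ∈ S.dualRootLattice := by
  obtain ⟨a, rfl⟩ := S.mem_dualRootLattice_iff.mp hq
  have hM' : (M : ℝ) ≠ 0 := by positivity
  have hM2 : (M : ℤ) ≠ 0 := by positivity
  refine ⟨fun i => ⟨(a i % M).toNat, ?_⟩, S.mem_dualRootLattice_iff.mpr ⟨fun i => a i / M, ?_⟩⟩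
  · have h1 := Int.emod_nonneg (a i) hM2
    have h2 := Int.emod_lt_of_pos (a i) (by omega : (0 : ℤ) < M)
    omega
  · rw [gridPoint, ← smul_sub, ← Finset.sum_sub_distrib, eq_inv_smul_iff₀ hM', Finset.smul_sum]
    refine Finset.sum_congr rfl fun i _ => ?_
    rw [Int.toNat_of_nonneg (Int.emod_nonneg _ hM2), ← sub_smul, ← Int.cast_smul_eq_zsmul ℝ,
      ← Int.cast_smul_eq_zsmul ℝ, smul_smul]
    congr 1
    have := Int.mul_ediv_add_emod (a i) M
    have h : (M : ℤ) * (a i / M) = a i - a i % M := by omega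
    exact_mod_cast h

lemma gridPoint_mem (M : ℕ) (k : Fin n → Fin M) :
    S.gridPoint M k ∈ (M : ℝ)⁻¹ • (S.dualRootLattice : Set (EuclideanSpace ℝ (Fin n))) :=
  Set.smul_mem_smul_set (S.mem_dualRootLattice_iff.mpr ⟨_, rfl⟩)

/-- Orthogonality of characters on `(1/M)Q^∨ / Q^∨`. -/
theorem sum_exp_gridPoint {M : ℕ} (hM : 0 < M) {μ : EuclideanSpace ℝ (Fin n)}
    (hμ : μ ∈ S.weightLattice) [Decidable ((M : ℝ)⁻¹ • μ ∈ S.weightLattice)] :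
    ∑ k, Complex.exp ((2 * Real.pi * ⟪μ, S.gridPoint M k⟫ : ℝ) * Complex.I) =
      if (M : ℝ)⁻¹ • μ ∈ S.weightLattice then (M : ℂ) ^ n else 0 := by
  choose m hm using hμ
  have hM' : (M : ℂ) ≠ 0 := by exact_mod_cast hM.ne'
  have hMr : (M : ℝ) ≠ 0 := by exact_mod_cast hM.ne'
  have hpi : (2 * Real.pi * Complex.I : ℂ) ≠ 0 := Complex.two_pi_I_ne_zero
  -- `z i` is the value of the character at αᵢ^∨/M, an M-th root of unity. The sum factors into
  -- geometric sums, and all `z i` are 1 exactly when μ/M ∈ P.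
  let z : Fin n → ℂ := fun i => Complex.exp (m i / M * (2 * Real.pi * Complex.I))
  have e (k : Fin n → Fin M) :
      Complex.exp ((2 * Real.pi * ⟪μ, S.gridPoint M k⟫ : ℝ) * Complex.I) =
        ∏ i, z i ^ (k i : ℕ) := by
    simp only [z, ← Complex.exp_nat_mul]
    rw [← Complex.exp_sum]
    congr 1
    have : ⟪μ, S.gridPoint M k⟫ = ∑ i, ((k i : ℕ) : ℝ) * (m i / M) := by
      rw [gridPoint, inner_smul_right, inner_sum, Finset.mul_sum]
      refine Finset.sum_congr rfl fun i _ => ?_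
      rw [← Int.cast_smul_eq_zsmul ℝ, inner_smul_right, hm]
      push_cast
      field_simp
    rw [this, Complex.ofReal_mul, Complex.ofReal_sum, Finset.mul_sum, Finset.sum_mul]
    refine Finset.sum_congr rfl fun i _ => ?_
    push_cast
    ring
  have hz (i : Fin n) : z i ^ M = 1 := by
    simp only [z]
    rw [← Complex.exp_nat_mul, Complex.exp_eq_one_iff]
    exact ⟨m i, by field_simp⟩
  have hsum : ∑ k : Fin n → Fin M, ∏ i, z i ^ (k i : ℕ) = ∏ i, ∑ j : Fin M, z i ^ (j : ℕ) := by
    rw [Finset.prod_univ_sum, Fintype.piFinset_univ]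
  have hiff : (M : ℝ)⁻¹ • μ ∈ S.weightLattice ↔ ∀ i, z i = 1 := by
    refine forall_congr' fun i => ?_
    rw [real_inner_smul_left, hm, Complex.exp_eq_one_iff]
    refine exists_congr fun j => ?_
    rw [mul_left_inj' hpi, inv_mul_eq_div]
    norm_cast
  simp only [e, hsum]
  split_ifs with h
  · rw [hiff] at h
    simp [h]
  · rw [hiff] at h
    push Not at h
    obtain ⟨i, hi⟩ := h
    exact Finset.prod_eq_zero (Finset.mem_univ i) (sum_fin_pow_eq_zero (hz i) hi)

lemma sum_cos_gridPoint {M : ℕ} (hM : 0 < M) {μ : EuclideanSpace ℝ (Fin n)}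
    (hμ : μ ∈ S.weightLattice) [Decidable ((M : ℝ)⁻¹ • μ ∈ S.weightLattice)] :
    ∑ k, Real.cos (2 * Real.pi * ⟪μ, S.gridPoint M k⟫) =
      if (M : ℝ)⁻¹ • μ ∈ S.weightLattice then (M : ℝ) ^ n else 0 := by
  have := congrArg Complex.re (S.sum_exp_gridPoint hM hμ)
  simp only [Complex.re_sum, Complex.exp_ofReal_mul_I_re] at this
  rw [this]
  split_ifs
  · norm_cast
  · rfl

/-- The character sum is real whether or not μ/M lies in P. -/
lemma sum_sin_gridPoint {M : ℕ} (hM : 0 < M) {μ : EuclideanSpace ℝ (Fin n)}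
    (hμ : μ ∈ S.weightLattice) :
    ∑ k, Real.sin (2 * Real.pi * ⟪μ, S.gridPoint M k⟫) = 0 := by
  classical
  have := congrArg Complex.im (S.sum_exp_gridPoint hM hμ)
  simp only [Complex.im_sum, Complex.exp_ofReal_mul_I_im] at this
  rw [this]
  split_ifs
  · norm_cast
  · rfl

lemma smul_mem_scaled_dualRootLattice {M : ℕ} (hM : 0 < M) (w : S.W)
    {x v : EuclideanSpace ℝ (Fin n)}
    (hx : x ∈ (M : ℝ)⁻¹ • (S.dualRootLattice : Set (EuclideanSpace ℝ (Fin n))))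
    (hv : v ∈ S.dualRootLattice) :
    w • x + v ∈ (M : ℝ)⁻¹ • (S.dualRootLattice : Set (EuclideanSpace ℝ (Fin n))) := by
  have hM' : (M : ℝ) ≠ 0 := by exact_mod_cast hM.ne'
  obtain ⟨q, hq, rfl⟩ := hx
  refine ⟨w • q + M • v, add_mem (S.weyl_smul_mem_dualRootLattice w hq) (nsmul_mem hv M), ?_⟩
  dsimp only
  rw [smul_add, weyl_smul_real, ← Nat.cast_smul_eq_nsmul ℝ, inv_smul_smul₀ hM']

/-- Weighted sums of invariant functions over the point set are sums over `(1/M)Q^∨ / Q^∨`. -/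
theorem sum_pointSet (σ : S.W →* ℤˣ) {M : ℕ} (hM : 0 < M) (f : EuclideanSpace ℝ (Fin n) → ℝ)
    (hf : ∀ (w : S.W), ∀ v ∈ S.dualRootLattice, ∀ x, f (w • x + v) = f x)
    (hf0 : ∀ x ∈ S.F, x ∉ S.Fσ σ → f x = 0) :
    ∑ s : S.pointSet σ M, S.ε s * f s = ∑ k, f (S.gridPoint M k) := by
  classical
  let N : EuclideanSpace ℝ (Fin n) → ℕ :=
    fun a => Nat.card {w : S.W // w • a - a ∈ S.dualRootLattice}
  have hN (a) : ((N a : ℕ) : ℝ) ≠ 0 := by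
    have : Nonempty {w : S.W // w • a - a ∈ S.dualRootLattice} := ⟨⟨1, by simp⟩⟩
    exact_mod_cast Nat.card_pos.ne'
  have hN' (a) : ((N a : ℕ) : ℝ) = ∑ w : S.W, if w • a - a ∈ S.dualRootLattice then 1 else 0 := by
    simp [N, Nat.card_eq_fintype_card, Fintype.card_subtype]
  -- points of `F` congruent to a grid point
  have hrep (k : Fin n → Fin M) : ∃ w₀ : S.W, ∃ v₀ ∈ S.dualRootLattice,
      w₀ • S.gridPoint M k + v₀ ∈ S.F ∧ ∀ s ∈ S.F, ∀ w : S.W,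
        w • s - S.gridPoint M k ∈ S.dualRootLattice → s = w₀ • S.gridPoint M k + v₀ := by
    obtain ⟨w₀, v₀, hv₀, h₀⟩ := S.exists_weyl_mem_F (S.gridPoint M k)
    refine ⟨w₀, v₀, hv₀, h₀, fun s hs w hw => ?_⟩
    have e : w₀ • S.gridPoint M k + v₀ =
        (w₀ * w) • s + (v₀ - w₀ • (w • s - S.gridPoint M k)) := by
      rw [mul_smul, smul_sub]
      abel
    rw [e] at h₀ ⊢
    exact (S.eq_of_mem_F (sub_mem hv₀ (S.weyl_smul_mem_dualRootLattice w₀ hw)) hs h₀).symm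
  -- Double counting of the triples (s, w, k) with ws congruent to the k-th grid point modulo Q^∨,
  -- each weighted by f(s)/N(s). Given s and w there is exactly one k, so s contributes |W|
  -- f(s)/N(s) = ε(s) f(s).
  calc ∑ s : S.pointSet σ M, S.ε s * f s
      = ∑ s : S.pointSet σ M, ∑ w : S.W, ∑ k,
          if w • (s : EuclideanSpace ℝ (Fin n)) - S.gridPoint M k ∈ S.dualRootLattice
            then f s / N s else 0 := by
        refine Finset.sum_congr rfl fun s _ => ?_
        have h1 (w : S.W) : ∑ k,
            (if w • (s : EuclideanSpace ℝ (Fin n)) - S.gridPoint M k ∈ S.dualRootLattice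
              then f s / N s else 0) = f s / N s := by
          obtain ⟨q, hq, hqs⟩ := S.smul_mem_scaled_dualRootLattice hM w s.2.1 (zero_mem _)
          obtain ⟨k, hk⟩ := S.exists_gridPoint hM hq
          dsimp only at hqs
          rw [hqs, add_zero] at hk
          rw [Finset.sum_eq_single k, if_pos hk]
          · intro l _ hl
            rw [if_neg]
            intro h
            have := sub_mem h hk
            rw [sub_sub_sub_cancel_left] at this
            exact hl (S.gridPoint_sub_gridPoint hM this).symm
          · intro h
            exact absurd (Finset.mem_univ k) h
        simp only [h1, Finset.sum_const, Finset.card_univ, nsmul_eq_mul]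
        rw [ε, card_stabilizer_affineWeylGroup, Nat.card_eq_fintype_card]
        ring
    _ = ∑ k, ∑ s : S.pointSet σ M, ∑ w : S.W,
          if w • (s : EuclideanSpace ℝ (Fin n)) - S.gridPoint M k ∈ S.dualRootLattice
            then f s / N s else 0 := by
        rw [Finset.sum_comm (s := (Finset.univ : Finset (Fin n → Fin M)))]
        exact Finset.sum_congr rfl fun s _ => Finset.sum_comm
    _ = ∑ k, f (S.gridPoint M k) := by
        refine Finset.sum_congr rfl fun k _ => ?_
        -- Given k, only the representative s₀ in F can occur. The admissible w then form a coset of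
        -- size N(s₀), leaving f(s₀); if s₀ is outside F^σ, both sides are zero.
        obtain ⟨w₀, v₀, hv₀, h₀, huniq⟩ := hrep k
        set s₀ := w₀ • S.gridPoint M k + v₀ with hs₀
        rw [← hf w₀ v₀ hv₀ (S.gridPoint M k), ← hs₀]
        by_cases hσ : s₀ ∈ S.Fσ σ
        · have hs₀P : s₀ ∈ S.pointSet σ M :=
            ⟨S.smul_mem_scaled_dualRootLattice hM w₀ (S.gridPoint_mem M k) hv₀, hσ⟩
          rw [Finset.sum_eq_single ⟨s₀, hs₀P⟩]
          · have h2 : ∑ w : S.W, (if w • s₀ - S.gridPoint M k ∈ S.dualRootLattice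
                then f s₀ / N s₀ else 0) =
                ∑ w : S.W, (if w • s₀ - s₀ ∈ S.dualRootLattice then 1 else 0) * (f s₀ / N s₀) := by
              refine Fintype.sum_equiv (Equiv.mulLeft w₀) _ _ fun w => ?_
              have hiff : (w₀ * w) • s₀ - s₀ ∈ S.dualRootLattice ↔
                  w • s₀ - S.gridPoint M k ∈ S.dualRootLattice := by
                have e : (w₀ * w) • s₀ - s₀ = w₀ • (w • s₀ - S.gridPoint M k) - v₀ := by
                  nth_rewrite 2 [hs₀]
                  rw [mul_smul, smul_sub]
                  abel
                rw [e]
                refine ⟨fun h => ?_, fun h => sub_mem (S.weyl_smul_mem_dualRootLattice w₀ h) hv₀⟩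
                have := S.weyl_smul_mem_dualRootLattice w₀⁻¹ (add_mem h hv₀)
                rwa [sub_add_cancel, inv_smul_smul] at this
              simp only [Equiv.coe_mulLeft, hiff, ite_mul, one_mul, zero_mul]
            dsimp only
            rw [h2, ← Finset.sum_mul, ← hN', mul_div_cancel₀ _ (hN s₀)]
          · intro s _ hs
            refine Finset.sum_eq_zero fun w _ => if_neg fun h => hs ?_
            exact Subtype.ext (huniq s s.2.2.1 w h)
          · intro h
            exact absurd (Finset.mem_univ _) h
        · rw [hf0 _ h₀ hσ]
          refine Finset.sum_eq_zero fun s _ => Finset.sum_eq_zero fun w _ => if_neg fun h => hσ ?_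
          rw [← huniq s s.2.2.1 w h]
          exact s.2.2

end SimpleRootSystem

/-! ### Hartley orbit functions: symmetry, vanishing and sums of products. -/

namespace SimpleRootSystem

variable {n : ℕ} (S : SimpleRootSystem n)

/-- This form isolates the difference of frequencies in a cosine, which detects orthogonality, and
the sum in a sine, which cancels over the grid. -/
lemma cas_mul_cas (s t : ℝ) : cas s * cas t = Real.cos (s - t) + Real.sin (s + t) := by
  rw [cas, cas, Real.cos_sub, Real.sin_add]
  ring

lemma cas_add_int_mul_two_pi (t : ℝ) (m : ℤ) : cas (t + m * (2 * Real.pi)) = cas t := by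
  rw [cas, cas, Real.cos_add_int_mul_two_pi, Real.sin_add_int_mul_two_pi]

lemma sign_sq (u : ℤˣ) : ((u : ℤ) : ℝ) * ((u : ℤ) : ℝ) = 1 := by
  rcases Int.units_eq_one_or u with rfl | rfl <;> norm_num

lemma hartleyOrbit_add (σ : S.W →* ℤˣ) {b v : EuclideanSpace ℝ (Fin n)}
    (hb : b ∈ S.weightLattice) (hv : v ∈ S.dualRootLattice) (x : EuclideanSpace ℝ (Fin n)) :
    S.hartleyOrbit σ b (x + v) = S.hartleyOrbit σ b x := by
  refine Finset.sum_congr rfl fun w _ => ?_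
  obtain ⟨m, hm⟩ := S.inner_weight_coroot_int (S.weyl_smul_mem_weightLattice w hb) hv
  rw [inner_add_right, hm, mul_add, mul_comm _ (m : ℝ), cas_add_int_mul_two_pi]

lemma hartleyOrbit_smul (σ : S.W →* ℤˣ) (u : S.W) (b x : EuclideanSpace ℝ (Fin n)) :
    S.hartleyOrbit σ b (u • x) = ((σ u : ℤ) : ℝ) * S.hartleyOrbit σ b x := by
  rw [hartleyOrbit, hartleyOrbit, Finset.mul_sum]
  refine (Fintype.sum_equiv (Equiv.mulLeft u) _ _ fun w => ?_).symm
  rw [Equiv.coe_mulLeft, mul_smul, inner_weyl_smul, map_mul]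
  push_cast
  ring

lemma hartleyOrbit_motion (σ : S.W →* ℤˣ) (u : S.W) {b v : EuclideanSpace ℝ (Fin n)}
    (hb : b ∈ S.weightLattice) (hv : v ∈ S.dualRootLattice) (x : EuclideanSpace ℝ (Fin n)) :
    S.hartleyOrbit σ b (u • x + v) = ((σ u : ℤ) : ℝ) * S.hartleyOrbit σ b x := by
  rw [S.hartleyOrbit_add σ hb hv, hartleyOrbit_smul]

/-- Some motion fixing `x` has sign -1, so the value at `x` equals its own negative. -/
lemma hartleyOrbit_eq_zero (σ : S.W →* ℤˣ) {b x : EuclideanSpace ℝ (Fin n)}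
    (hb : b ∈ S.weightLattice) (hx : x ∈ S.F) (hxσ : x ∉ S.Fσ σ) :
    S.hartleyOrbit σ b x = 0 := by
  have : ∃ g ∈ MulAction.stabilizer S.affineWeylGroup x,
      σ (g : S.AffineMotion).right ≠ 1 := by
    by_contra! h
    exact hxσ ⟨hx, h⟩
  obtain ⟨g, hg, hσ⟩ := this
  have h1 : (g : S.AffineMotion).right • x + (g : S.AffineMotion).left.toAdd = x := hg
  have h2 := S.hartleyOrbit_motion σ (g : S.AffineMotion).right hb g.2 x
  rw [h1, (Int.units_eq_one_or _).resolve_left hσ] at h2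
  push_cast at h2
  linarith

/-- The sum over `(1/M)Q^∨ / Q^∨` of a product of two Hartley orbit functions. -/
theorem sum_hartleyOrbit_mul (σ : S.W →* ℤˣ) {M : ℕ} (hM : 0 < M)
    {μ ν : EuclideanSpace ℝ (Fin n)} (hμ : μ ∈ S.weightLattice) (hν : ν ∈ S.weightLattice)
    [DecidablePred (· ∈ S.weightLattice)] :
    ∑ k, S.hartleyOrbit σ μ (S.gridPoint M k) * S.hartleyOrbit σ ν (S.gridPoint M k) =
      Nat.card S.W * (M : ℝ) ^ n * ∑ w : S.W,
        if w • ((M : ℝ)⁻¹ • μ) - (M : ℝ)⁻¹ • ν ∈ S.weightLattice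
          then ((σ w : ℤ) : ℝ) else 0 := by
  have inner_sum (w u : S.W) :
      ∑ k, cas (2 * Real.pi * ⟪w • μ, S.gridPoint M k⟫) *
        cas (2 * Real.pi * ⟪u • ν, S.gridPoint M k⟫) =
      if (M : ℝ)⁻¹ • (w • μ - u • ν) ∈ S.weightLattice then (M : ℝ) ^ n else 0 := by
    have hw := S.weyl_smul_mem_weightLattice w hμ
    have hu := S.weyl_smul_mem_weightLattice u hν
    simp only [cas_mul_cas, ← mul_sub, ← mul_add, ← inner_sub_left, ← inner_add_left]
    rw [Finset.sum_add_distrib, S.sum_cos_gridPoint hM (sub_mem hw hu),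
      S.sum_sin_gridPoint hM (add_mem hw hu), add_zero]
  have inner_sum' (u : S.W) :
      ∑ w : S.W, ((σ w : ℤ) : ℝ) * ((σ u : ℤ) : ℝ) *
        (if (M : ℝ)⁻¹ • (w • μ - u • ν) ∈ S.weightLattice then (M : ℝ) ^ n else 0) =
      ∑ w : S.W, (M : ℝ) ^ n * (if w • ((M : ℝ)⁻¹ • μ) - (M : ℝ)⁻¹ • ν ∈ S.weightLattice
        then ((σ w : ℤ) : ℝ) else 0) := by
    -- Replacing w by uw removes u from the condition, as P is W-invariant, and turns the sign into
    -- σ(u)²σ(w). The inner sum is the same for every u, whence the factor |W|.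
    refine (Fintype.sum_equiv (Equiv.mulLeft u) _ _ fun w => ?_).symm
    have e : (M : ℝ)⁻¹ • ((u * w) • μ - u • ν) =
        u • (w • ((M : ℝ)⁻¹ • μ) - (M : ℝ)⁻¹ • ν) := by
      rw [smul_sub u, mul_smul]
      simp only [weyl_smul_real]
      rw [smul_sub]
    have hiff : (M : ℝ)⁻¹ • ((u * w) • μ - u • ν) ∈ S.weightLattice ↔
        w • ((M : ℝ)⁻¹ • μ) - (M : ℝ)⁻¹ • ν ∈ S.weightLattice := by
      rw [e]
      refine ⟨fun h => ?_, S.weyl_smul_mem_weightLattice u⟩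
      have := S.weyl_smul_mem_weightLattice u⁻¹ h
      rwa [inv_smul_smul] at this
    simp only [Equiv.coe_mulLeft, hiff, map_mul, mul_ite, mul_zero]
    split_ifs
    · push_cast
      linear_combination (-(M : ℝ) ^ n * ((σ w : ℤ) : ℝ)) * sign_sq (σ u)
    · rfl
  calc ∑ k, S.hartleyOrbit σ μ (S.gridPoint M k) * S.hartleyOrbit σ ν (S.gridPoint M k)
      = ∑ k, ∑ u : S.W, ∑ w : S.W, ((σ w : ℤ) : ℝ) * ((σ u : ℤ) : ℝ) *
          (cas (2 * Real.pi * ⟪w • μ, S.gridPoint M k⟫) *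
            cas (2 * Real.pi * ⟪u • ν, S.gridPoint M k⟫)) := by
        refine Finset.sum_congr rfl fun k _ => ?_
        rw [hartleyOrbit, hartleyOrbit, Finset.sum_mul_sum, Finset.sum_comm]
        refine Finset.sum_congr rfl fun u _ => Finset.sum_congr rfl fun w _ => ?_
        ring
    _ = ∑ u : S.W, ∑ w : S.W, ((σ w : ℤ) : ℝ) * ((σ u : ℤ) : ℝ) *
          ∑ k, cas (2 * Real.pi * ⟪w • μ, S.gridPoint M k⟫) *
            cas (2 * Real.pi * ⟪u • ν, S.gridPoint M k⟫) := by
        rw [Finset.sum_comm]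
        refine Finset.sum_congr rfl fun u _ => ?_
        rw [Finset.sum_comm]
        refine Finset.sum_congr rfl fun w _ => ?_
        rw [Finset.mul_sum]
    _ = _ := by
        simp only [inner_sum, inner_sum', ← Finset.mul_sum]
        rw [Finset.sum_const, Finset.card_univ, nsmul_eq_mul, Nat.card_eq_fintype_card]
        ring

/-- A Weyl group element that carries `b` to `b'` modulo the weight lattice gives an element of the
extended dual affine Weyl group. -/
lemma exists_motion_of_sub_mem {w : S.W} {b b' : EuclideanSpace ℝ (Fin n)}
    (h : w • b - b' ∈ S.weightLattice) :
    ∃ g : S.extendedDualAffineWeylGroup, (g : S.AffineMotion).right = w ∧ g • b = b' := by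
  have h' := neg_mem h
  rw [neg_sub] at h'
  refine ⟨⟨S.motion w (b' - w • b), h'⟩, rfl, ?_⟩
  change w • b + (b' - w • b) = b'
  abel

end SimpleRootSystem

/-! ### Discrete orthogonality. -/

theorem mainTheorem6 {n : ℕ} (S : SimpleRootSystem n) (σ : S.W →* ℤˣ) (M : ℕ) (hM : 0 < M)
    (μ ν : EuclideanSpace ℝ (Fin n)) (hμ : μ ∈ S.weightSet σ M) (hν : ν ∈ S.weightSet σ M) :
    S.scalarProduct σ M (fun s => (S.hartleyOrbit σ μ s : ℂ)) (fun s => (S.hartleyOrbit σ ν s : ℂ)) =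
      (Nat.card S.W : ℂ) * (M : ℂ) ^ n * (S.hPM M μ : ℂ) *
        (open scoped Classical in if μ = ν then 1 else 0) := by
  classical
  have hM' : (M : ℝ) ≠ 0 := by exact_mod_cast hM.ne'
  have h1 := S.sum_pointSet σ hM (fun x => S.hartleyOrbit σ μ x * S.hartleyOrbit σ ν x)
    (fun w v hv x => by
      rw [S.hartleyOrbit_motion σ w hμ.1 hv, S.hartleyOrbit_motion σ w hν.1 hv, mul_mul_mul_comm,
        SimpleRootSystem.sign_sq, one_mul])
    (fun x hx hxσ => by rw [S.hartleyOrbit_eq_zero σ hμ.1 hx hxσ, zero_mul])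
  have h2 : S.scalarProduct σ M (fun s => (S.hartleyOrbit σ μ s : ℂ))
      (fun s => (S.hartleyOrbit σ ν s : ℂ)) =
      ((∑ s : S.pointSet σ M, S.ε s * (S.hartleyOrbit σ μ s * S.hartleyOrbit σ ν s) : ℝ) : ℂ) := by
    rw [SimpleRootSystem.scalarProduct, Complex.ofReal_sum]
    refine Finset.sum_congr rfl fun s _ => ?_
    rw [Complex.conj_ofReal]
    push_cast
    ring
  -- Each w counted is the linear part of a motion carrying μ/M to ν/M. For μ ≠ ν there is none by
  -- uniqueness in F_P; for μ = ν every sign is 1 by the definition of F_P^σ, and the sum counts the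
  -- stabilizer.
  have h3 : (∑ w : S.W, if w • ((M : ℝ)⁻¹ • μ) - (M : ℝ)⁻¹ • ν ∈ S.weightLattice
      then ((σ w : ℤ) : ℝ) else 0) = S.hPM M μ * if μ = ν then 1 else 0 := by
    obtain ⟨-, b, hb, rfl⟩ := hμ
    obtain ⟨-, b', hb', rfl⟩ := hν
    dsimp only
    rw [S.hPM_eq, inv_smul_smul₀ hM', inv_smul_smul₀ hM']
    split_ifs with hbb
    · have hbb' : b = b' := smul_right_injective _ hM' hbb
      subst hbb'
      rw [Nat.card_eq_fintype_card, Fintype.card_subtype, mul_one, Finset.card_filter,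
        Nat.cast_sum]
      refine Finset.sum_congr rfl fun w _ => ?_
      split_ifs with hw
      · obtain ⟨g, rfl, hg⟩ := S.exists_motion_of_sub_mem hw
        rw [hb.2 g hg]
        norm_num
      · norm_num
    · rw [mul_zero]
      refine Finset.sum_eq_zero fun w _ => if_neg fun hw => hbb ?_
      obtain ⟨g, -, hg⟩ := S.exists_motion_of_sub_mem hw
      rw [S.eq_of_mem_FP hb.1 hb'.1 hg]
  rw [h2, h1, S.sum_hartleyOrbit_mul σ hM hμ.1 hν.1, h3]
  split_ifs <;> push_cast <;> ring
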